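/- Let $X_1,X_2,\dots$ be i.i.d. random variables with distribution function $F$ and $X_1\ge 1$ almost surely. Let $F^-(q)=\inf\{x:F(x)\ge q\}$, $U(y)=F^-(1-1/y)$, and for $p\in(0,1)$ let $x_p=F^-(1-p)$. Assume the second-order condition (U): there are $\gamma>0$, $\rho<0$ and a measurable function $A$ with $A(t)\to0$ as $t\to\infty$ such that, for all $x>0$, $$\lim_{t\to\infty}\frac{U(tx)/U(t)-x^{\gamma}}{A(t)}=x^{\gamma}\,\frac{x^{\rho}-1}{\rho}.$$ Let $r\ge1$ be a fixed integer, let $k_n$ be positive integers (the numbers of blocks) and $m_n=\lfloor n/k_n\rfloor$. For $1\le i\le k_n$ let $X^{(i)}_{m_n,1}\ge\dots\ge X^{(i)}_{m_n,m_n}$ be the order statistics of the $i$-th block $X_{(i-1)m_n+1},\dots,X_{im_n}$. Put $$\widehat\gamma_n=\frac1{k_nr}\sum_{i=1}^{k_n}\sum_{j=1}^{r}\big(\log X^{(i)}_{m_n,j}-\log X^{(i)}_{m_n,r+1}\big),\qquad a(m,r,p)=\sum_{j=r+1}^{m}\frac1j+\log p,$$ $$\widehat x_{p_n}=\exp\Big(\frac1{k_n}\sum_{i=1}^{k_n}\log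 X^{(i)}_{m_n,r+1}-a(m_n,r,p_n)\,\widehat\gamma_n\Big).$$ Assume that, as $n\to\infty$, $k_n\to\infty$, $m_n\to\infty$ and $k_n^{1/2}A(m_n)\to\delta\in(-\infty,\infty)$, and that $p_n\in(0,1)$ satisfies $m_np_n\to0$ and $\log(m_np_n)=o(k_n^{1/2})$. Then $$\frac{(rk_n)^{1/2}}{|a(m_n,r,p_n)|}\big(\log\widehat x_{p_n}-\log x_{p_n}\big)\ \xrightarrow{\ d\ }\ N(\delta b_r,\gamma^2),$$ where $$b_r=\frac1{\sqrt r\,\rho}\Big(\sum_{j=1}^{r}\frac{\Gamma(j-\rho)}{(j-1)!}-\frac{\Gamma(r+1-\rho)}{(r-1)!}\Big).$$ -/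

import Mathlib

open MeasureTheory ProbabilityTheory Filter Topology

noncomputable section

namespace BlockQuantile

/-- Generalized (left-continuous) inverse `F⁻(q) = inf {x : F(x) ≥ q}` of the distribution
function `F` of the law `μ`. -/
def genInv (μ : Measure ℝ) (q : ℝ) : ℝ :=
  sInf {x : ℝ | q ≤ cdf μ x}

/-- The tail quantile function `U(y) = F⁻(1 - 1/y)`. -/
def tailQuantile (μ : Measure ℝ) (y : ℝ) : ℝ :=
  genInv μ (1 - 1 / y)

/-- The high quantile `x_p = F⁻(1 - p)`. -/
def highQuantile (μ : Measure ℝ) (p : ℝ) : ℝ :=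
  genInv μ (1 - p)

/-- The second-order condition on the tail quantile function, with tail parameter `γ`,
second-order parameter `ρ` and auxiliary function `A`. -/
structure SecondOrder (μ : Measure ℝ) (γ ρ : ℝ) (A : ℝ → ℝ) : Prop where
  measurable : Measurable A
  tendsto_zero : Tendsto A atTop (𝓝 0)
  tendsto_ratio : ∀ x : ℝ, 0 < x →
    Tendsto (fun t : ℝ =>
        (tailQuantile μ (t * x) / tailQuantile μ t - x ^ γ) / A t)
      atTop (𝓝 (x ^ γ * ((x ^ ρ - 1) / ρ)))

/-- The `j`-th largest (`1 ≤ j ≤ m`, with multiplicity) of the `m` numbers `v 0, …, v (m - 1)`;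
it is the entry with zero-based position `m - j` in the nondecreasing rearrangement of `v`.
The value outside `1 ≤ j ≤ m` is irrelevant. -/
def orderStat {m : ℕ} (v : Fin m → ℝ) (j : ℕ) : ℝ :=
  if h : 1 ≤ j ∧ j ≤ m then v (Tuple.sort v ⟨m - j, by omega⟩) else 0

/-- `X_{m,j}^{(i)}`: the `j`-th largest observation of the `i`-th block of length `m` of the
sequence `x`. Blocks and observations are numbered from `0`: block `i` consists of
`x (i * m), …, x (i * m + m - 1)`. -/
def blockOrderStat (x : ℕ → ℝ) (m i j : ℕ) : ℝ :=
  orderStat (fun l : Fin m => x (i * m + l)) j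

/-- The Hill-type estimator of `γ` from the `r + 1` largest observations of each of the `k`
blocks of length `m`. -/
def gammaHat (x : ℕ → ℝ) (k m r : ℕ) : ℝ :=
  1 / ((k : ℝ) * r) * ∑ i ∈ Finset.range k, ∑ j ∈ Finset.Icc 1 r,
    (Real.log (blockOrderStat x m i j) - Real.log (blockOrderStat x m i (r + 1)))

/-- `a(m, r, p) = ∑_{j=r+1}^m 1/j + log p`. -/
def aCoef (m r : ℕ) (p : ℝ) : ℝ :=
  (∑ j ∈ Finset.Icc (r + 1) m, 1 / (j : ℝ)) + Real.log p

/-- The high quantile estimator from block data. -/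
def quantileHat (x : ℕ → ℝ) (k m r : ℕ) (p : ℝ) : ℝ :=
  Real.exp (1 / (k : ℝ) * (∑ i ∈ Finset.range k, Real.log (blockOrderStat x m i (r + 1)))
    - aCoef m r p * gammaHat x k m r)

/-- The bias constant `b_r`, normalized for the rate `(r k_n)^{1/2}`. -/
def biasConst (r : ℕ) (ρ : ℝ) : ℝ :=
  1 / (Real.sqrt r * ρ) *
    ((∑ j ∈ Finset.Icc 1 r, Real.Gamma (j - ρ) / (Nat.factorial (j - 1) : ℝ))
      - Real.Gamma (r + 1 - ρ) / (Nat.factorial (r - 1) : ℝ))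

end BlockQuantile

end

/-! The observations may be taken to be quantile transforms of independent standard exponentials
`E`, because the statistic depends on the data only through their joint law
(`map_expQuantile_expSeq`, `tendstoInDistribution_of_map_eq`). Write `b` for `logRemainder`. In
exponential scale the second-order condition forces `log U(exp u) = c + γ u + b(u)`, with `b(u) /
A(exp u) → 1/ρ` (`SecondOrder.exists_logRemainder`). The quantile transform is monotone, so the same
expansion holds at each order statistic of a block.

Since `aCoef` is eventually negative, the normalized error splits exactly (`normalized_error_eq`)
into `γ` times a normalized sum of centered spacing sums and a mean of block residuals. By the
memoryless property, the sum of the top `r` spacings of a block has exactly the law of a sum of `r`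
independent exponentials, whatever the block length. The first term therefore obeys the ordinary
central limit theorem and yields the variance `γ ^ 2` (`tendstoInDistribution_spacingSum`).

The residual term tends in probability to a constant. Its variance vanishes because `|aCoef| → ∞`
and `b → 0`. In its mean, the harmonic sum in `aCoef` is exactly the expectation of the exponential
order statistic of rank `r + 1`, so only expectations of `b` survive (`integral_blockResidual`). An
exponential order statistic of rank `j` minus `log m` has a limiting density proportional to `exp(-j
y) exp(-exp(-y))`, and `b(log m + y) / b(log m) → exp(ρ y)`. Under the Potter bound this gives `E
b(E_{m,j}) ~ b(log m) Γ(j - ρ) / (j - 1)!`. Together with `√k b(log m) → δ / ρ` it produces the bias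
`δ b_r`, and Slutsky's theorem combines the two terms. -/

namespace BlockQuantile

open scoped ENNReal

/-! ### Order statistics of a finite tuple. -/

section OrderStat

variable {m : ℕ}

lemma orderStat_of_mem (v : Fin m → ℝ) {j : ℕ} (h : 1 ≤ j ∧ j ≤ m) :
    orderStat v j = v (Tuple.sort v ⟨m - j, by omega⟩) := by
  rw [orderStat, dif_pos h]

/-- Counting exceedances replaces the sorting permutation. Measurability and the effect of adjoining
a new minimum are both read off from this count. -/
lemma le_orderStat_iff (v : Fin m → ℝ) {j : ℕ} (hj : 1 ≤ j) (hjm : j ≤ m) (a : ℝ) :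
    a ≤ orderStat v j ↔ j ≤ (Finset.univ.filter fun i => a ≤ v i).card := by
  have hanti : Antitone (v ∘ Tuple.sort v ∘ Fin.rev) := fun x y hxy =>
    Tuple.monotone_sort v (Fin.rev_le_rev.2 hxy)
  have h := Tuple.lt_card_ge_iff_apply_ge_of_antitone (j := ⟨j - 1, by omega⟩) (a := a) hanti
  have hcard : (Finset.univ.filter fun i => a ≤ (v ∘ Tuple.sort v ∘ Fin.rev) i).card
      = (Finset.univ.filter fun i => a ≤ v i).card :=
    Finset.card_equiv (Fin.revPerm.trans (Tuple.sort v)) (by intro i; simp)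
  rw [hcard] at h
  rw [orderStat_of_mem v ⟨hj, hjm⟩]
  have he : (v ∘ Tuple.sort v ∘ Fin.rev) ⟨j - 1, by omega⟩
      = v (Tuple.sort v ⟨m - j, by omega⟩) := by
    simp only [Function.comp]
    congr 2
    ext
    simp only [Fin.val_rev]
    omega
  rw [he] at h
  rw [← h]
  change j - 1 < _ ↔ _
  omega

lemma orderStat_comp_perm (v : Fin m → ℝ) (σ : Equiv.Perm (Fin m)) (j : ℕ) :
    orderStat (v ∘ σ) j = orderStat v j := by
  unfold orderStat
  split_ifs with h
  · exact congrFun (Tuple.comp_perm_comp_sort_eq_comp_sort (f := v) (σ := σ)) _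
  · rfl

/-- A nondecreasing image of a sorted tuple is sorted, so ties created by `f` are harmless. This
carries the exponential order statistics to those of the data. -/
lemma orderStat_comp_of_monotoneOn {f : ℝ → ℝ} {s : Set ℝ} (hf : MonotoneOn f s) {v : Fin m → ℝ}
    (hv : ∀ i, v i ∈ s) {j : ℕ} (hj : 1 ≤ j) (hjm : j ≤ m) :
    orderStat (fun i => f (v i)) j = f (orderStat v j) := by
  rw [orderStat_of_mem _ ⟨hj, hjm⟩, orderStat_of_mem _ ⟨hj, hjm⟩]
  have hmono : Monotone ((fun i => f (v i)) ∘ Tuple.sort v) := fun x y hxy =>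
    hf (hv _) (hv _) (Tuple.monotone_sort v hxy)
  exact (congrFun (Tuple.comp_sort_eq_comp_iff_monotone.2 hmono) _).symm

lemma exists_orderStat_eq (v : Fin m → ℝ) {j : ℕ} (hj : 1 ≤ j) (hjm : j ≤ m) :
    ∃ i, orderStat v j = v i := ⟨_, orderStat_of_mem v ⟨hj, hjm⟩⟩

lemma measurable_orderStat (j : ℕ) : Measurable fun v : Fin m → ℝ => orderStat v j := by
  by_cases h : 1 ≤ j ∧ j ≤ m
  · refine measurable_of_Ici fun a => ?_
    have hset : (fun v : Fin m → ℝ => orderStat v j) ⁻¹' Set.Ici a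
        = {v | j ≤ ∑ i : Fin m, (Set.Ici a).indicator (fun _ => 1) (v i)} := by
      ext v
      simp only [Set.mem_preimage, Set.mem_Ici, le_orderStat_iff v h.1 h.2, Set.mem_ofPred_eq,
        Set.indicator_apply, Finset.sum_boole, Nat.cast_id]
    rw [hset]
    refine measurableSet_le measurable_const (Finset.measurable_fun_sum _ fun i _ => ?_)
    exact (measurable_const.indicator measurableSet_Ici).comp (measurable_pi_apply i)
  · have : (fun v : Fin m → ℝ => orderStat v j) = fun _ => 0 := by
      ext v
      rw [orderStat, dif_neg h]
    rw [this]
    exact measurable_const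

/-- A new strict minimum takes the last rank and leaves the others alone. This is the combinatorial
half of every induction on the sample size below. -/
lemma orderStat_cons_add {u : ℝ} {e : Fin m → ℝ} (he : ∀ i, 0 < e i) {j : ℕ}
    (hj : 1 ≤ j) (hjm : j ≤ m) :
    orderStat (Fin.cons u (fun i => u + e i) : Fin (m + 1) → ℝ) j = u + orderStat e j := by
  refine eq_of_forall_le_iff fun a => ?_
  rw [le_orderStat_iff _ hj (by omega), ← sub_le_iff_le_add', le_orderStat_iff _ hj hjm,
    Fin.card_filter_univ_succ]
  simp only [Fin.cons_zero, Fin.cons_succ, sub_le_iff_le_add']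
  split_ifs with h
  · have : (Finset.univ.filter fun i => a ≤ u + e i) = Finset.univ :=
      Finset.filter_true_of_mem fun i _ => by linarith [he i]
    rw [this, Finset.card_univ, Fintype.card_fin]
    omega
  · exact Iff.rfl

lemma orderStat_cons_add_last {u : ℝ} {e : Fin m → ℝ} (he : ∀ i, 0 < e i) :
    orderStat (Fin.cons u (fun i => u + e i) : Fin (m + 1) → ℝ) (m + 1) = u := by
  refine eq_of_forall_le_iff fun a => ?_
  rw [le_orderStat_iff _ (by omega) le_rfl, Fin.card_filter_univ_succ]
  simp only [Fin.cons_zero, Fin.cons_succ]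
  have hc : (Finset.univ.filter fun i => a ≤ u + e i).card ≤ m :=
    (Finset.card_le_univ _).trans (by simp)
  split_ifs with h
  · have : (Finset.univ.filter fun i => a ≤ u + e i) = Finset.univ :=
      Finset.filter_true_of_mem fun i _ => by linarith [he i]
    rw [this, Finset.card_univ, Fintype.card_fin]
    simp [h]
  · simp only [h, iff_false]
    omega

lemma sum_orderStat (v : Fin m → ℝ) : ∑ j ∈ Finset.Icc 1 m, orderStat v j = ∑ i, v i := by
  have h1 : ∑ i, v i = ∑ i, v (Tuple.sort v i) := (Equiv.sum_comp (Tuple.sort v) v).symm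
  rw [h1, ← Equiv.sum_comp Fin.revPerm, ← Finset.sum_coe_sort]
  refine Finset.sum_bij' (fun (x : Finset.Icc 1 m) _ => (⟨x.1 - 1, by
      have := Finset.mem_Icc.1 x.2; omega⟩ : Fin m))
    (fun i _ => ⟨i + 1, Finset.mem_Icc.2 ⟨by omega, by omega⟩⟩) ?_ ?_ ?_ ?_ ?_
  · simp
  · simp
  · rintro ⟨x, hx⟩ -
    have := Finset.mem_Icc.1 hx
    simp only [Subtype.mk.injEq]
    omega
  · simp
  · rintro ⟨x, hx⟩ -
    have hx' := Finset.mem_Icc.1 hx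
    simp only
    rw [orderStat_of_mem v hx']
    congr 2
    ext
    simp only [Fin.revPerm_apply, Fin.val_rev]
    omega

end OrderStat

/-! ### Generalized inverse and the exponential quantile transform. -/

section GenInv

variable (μ : Measure ℝ)

/-- The quantile transform carrying the standard exponential law to `μ`. It is set to `1`
off the positive half-line. -/
noncomputable def expQuantile (e : ℝ) : ℝ :=
  if 0 < e then genInv μ (1 - Real.exp (-e)) else 1

lemma expQuantile_of_pos {e : ℝ} (he : 0 < e) :
    expQuantile μ e = genInv μ (1 - Real.exp (-e)) := if_pos he

/-- Right-continuity of the distribution function makes the infimum attained; restricting to `0 < q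
< 1` makes the set nonempty and bounded below. -/
lemma genInv_le_iff {q : ℝ} (hq : q ∈ Set.Ioo (0 : ℝ) 1) (x : ℝ) :
    genInv μ q ≤ x ↔ q ≤ cdf μ x := by
  have hne : {x : ℝ | q ≤ cdf μ x}.Nonempty :=
    ((tendsto_cdf_atTop μ).eventually_const_le hq.2).exists
  obtain ⟨y, hy⟩ := ((tendsto_cdf_atBot μ).eventually_lt_const hq.1).exists
  have hbdd : BddBelow {x : ℝ | q ≤ cdf μ x} := by
    refine ⟨y, fun z hz => ?_⟩
    by_contra! hzy
    exact absurd (hz.trans (monotone_cdf μ hzy.le)) (not_le.2 hy)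
  refine ⟨fun h => ?_, fun h => csInf_le hbdd h⟩
  have hright : Tendsto (cdf μ) (𝓝[>] x) (𝓝 (cdf μ x)) :=
    ((cdf μ).right_continuous x).tendsto.mono_left (nhdsWithin_mono _ Set.Ioi_subset_Ici_self)
  refine ge_of_tendsto hright ?_
  filter_upwards [self_mem_nhdsWithin] with z hz
  obtain ⟨w, hw, hwz⟩ := (csInf_lt_iff hbdd hne).1 (h.trans_lt hz)
  exact le_trans hw (monotone_cdf μ hwz.le)

lemma genInv_monotoneOn : MonotoneOn (genInv μ) (Set.Ioo 0 1) := fun q hq q' hq' h => by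
  rw [genInv_le_iff μ hq]
  exact h.trans ((genInv_le_iff μ hq' _).1 le_rfl)

lemma one_le_genInv [IsProbabilityMeasure μ] (hμ : μ (Set.Iio 1) = 0) {q : ℝ} (hq : q ∈ Set.Ioo (0 : ℝ) 1) :
    1 ≤ genInv μ q := by
  by_contra! h
  have h1 := (genInv_le_iff μ hq _).1 le_rfl
  have h2 : μ (Set.Iic (genInv μ q)) = 0 :=
    measure_mono_null (Set.Iic_subset_Iio.2 h) hμ
  rw [cdf_eq_real, Measure.real, h2] at h1
  simp only [ENNReal.toReal_zero] at h1
  linarith [hq.1]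

lemma one_sub_exp_neg_mem_Ioo {e : ℝ} (he : 0 < e) : 1 - Real.exp (-e) ∈ Set.Ioo (0 : ℝ) 1 := by
  constructor
  · have := Real.exp_lt_one_iff.2 (neg_lt_zero.2 he)
    linarith
  · linarith [Real.exp_pos (-e)]

lemma expQuantile_monotoneOn : MonotoneOn (expQuantile μ) (Set.Ioi 0) := fun x hx y hy h => by
  rw [expQuantile_of_pos μ hx, expQuantile_of_pos μ hy]
  refine genInv_monotoneOn μ (one_sub_exp_neg_mem_Ioo hx) (one_sub_exp_neg_mem_Ioo hy) ?_
  have := Real.exp_le_exp.2 (neg_le_neg h)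
  linarith

lemma one_le_expQuantile [IsProbabilityMeasure μ] (hμ : μ (Set.Iio 1) = 0) (e : ℝ) : 1 ≤ expQuantile μ e := by
  by_cases he : 0 < e
  · rw [expQuantile_of_pos μ he]
    exact one_le_genInv μ hμ (one_sub_exp_neg_mem_Ioo he)
  · rw [expQuantile, if_neg he]

lemma measurable_expQuantile : Measurable (expQuantile μ) := by
  refine measurable_of_Iic fun a => ?_
  have : expQuantile μ ⁻¹' Set.Iic a
      = (Set.Ioi 0 ∩ {e | 1 - Real.exp (-e) ≤ cdf μ a}) ∪ (Set.Iic 0 ∩ {_e : ℝ | (1 : ℝ) ≤ a}) := by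
    ext e
    by_cases he : 0 < e
    · have := genInv_le_iff μ (one_sub_exp_neg_mem_Ioo he) a
      simp only [Set.mem_preimage, Set.mem_Iic, expQuantile_of_pos μ he, this, Set.mem_union,
        Set.mem_inter_iff, Set.mem_Ioi, he, Set.mem_ofPred_eq, true_and, not_le.2 he, false_and,
        or_false]
    · have h1 : expQuantile μ e = 1 := if_neg he
      simp only [Set.mem_preimage, Set.mem_Iic, h1, Set.mem_union,
        Set.mem_inter_iff, Set.mem_Ioi, he, Set.mem_ofPred_eq, not_lt.1 he, false_and,
        false_or, true_and]
  rw [this]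
  refine (measurableSet_Ioi.inter ?_).union (measurableSet_Iic.inter (MeasurableSet.const _))
  exact measurableSet_le (by fun_prop) measurable_const

lemma map_expQuantile [IsProbabilityMeasure μ] : (expMeasure 1).map (expQuantile μ) = μ := by
  have := isProbabilityMeasure_expMeasure (r := 1) one_pos
  have hm := measurable_expQuantile μ
  have hpos : ∀ᵐ e ∂(expMeasure 1), 0 < e := by
    have h := cdf_expMeasure_eq (r := 1) one_pos 0
    rw [cdf_eq_real] at h
    simp only [le_refl, if_true, mul_zero, neg_zero, Real.exp_zero, sub_self] at h
    rw [measureReal_eq_zero_iff] at h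
    rw [ae_iff]
    simpa [Set.Iic] using h
  have := Measure.isProbabilityMeasure_map (μ := expMeasure 1) hm.aemeasurable
  refine Measure.eq_of_cdf _ _ ?_
  ext x
  rw [cdf_eq_real, map_measureReal_apply hm measurableSet_Iic]
  have hset : (expQuantile μ ⁻¹' Set.Iic x : Set ℝ) =ᵐ[expMeasure 1]
      {e : ℝ | 1 - Real.exp (-e) ≤ cdf μ x} := by
    filter_upwards [hpos] with e he
    refine propext ?_
    change expQuantile μ e ≤ x ↔ 1 - Real.exp (-e) ≤ cdf μ x
    rw [expQuantile_of_pos μ he, genInv_le_iff μ (one_sub_exp_neg_mem_Ioo he)]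
  rw [measureReal_congr hset]
  -- When `F(x) = 1` the threshold `-log (1 - F(x))` is infinite, so that case is separate.
  rcases (cdf_le_one μ x).lt_or_eq with h1 | h1
  · have : {e : ℝ | 1 - Real.exp (-e) ≤ cdf μ x} = Set.Iic (-Real.log (1 - cdf μ x)) := by
      ext e
      simp only [Set.mem_ofPred_eq, Set.mem_Iic]
      rw [le_neg, Real.log_le_iff_le_exp (by linarith)]
      constructor <;> intro h <;> linarith
    rw [this, ← cdf_eq_real, cdf_expMeasure_eq one_pos, if_pos, one_mul, neg_neg,
      Real.exp_log (by linarith)]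
    · ring
    · have := Real.log_nonpos (x := 1 - cdf μ x) (by linarith) (by linarith [cdf_nonneg μ x])
      linarith
  · have : {e : ℝ | 1 - Real.exp (-e) ≤ cdf μ x} = Set.univ := by
      ext e
      simp only [Set.mem_ofPred_eq, Set.mem_univ, iff_true, h1]
      linarith [Real.exp_pos (-e)]
    rw [this, h1, probReal_univ]

end GenInv

/-! ### Memoryless decomposition of independent exponentials. -/

section StdExp

/-- The standard exponential law. -/
noncomputable def stdExp : Measure ℝ := expMeasure 1

instance : IsProbabilityMeasure stdExp := isProbabilityMeasure_expMeasure one_pos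

/-- The joint law of `m` independent standard exponential variables. -/
noncomputable def stdExpPi (m : ℕ) : Measure (Fin m → ℝ) := Measure.pi fun _ => stdExp

instance (m : ℕ) : IsProbabilityMeasure (stdExpPi m) := by
  unfold stdExpPi; infer_instance

lemma lintegral_stdExp {f : ℝ → ℝ≥0∞} (hf : Measurable f) :
    ∫⁻ x, f x ∂stdExp = ∫⁻ x in Set.Ioi 0, ENNReal.ofReal (Real.exp (-x)) * f x := by
  have h : stdExp = volume.withDensity (exponentialPDF 1) := rfl
  have hm : Measurable (exponentialPDF 1) := (measurable_exponentialPDFReal 1).ennreal_ofReal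
  rw [h, lintegral_withDensity_eq_lintegral_mul _ hm hf, setLIntegral_congr Ioi_ae_eq_Ici,
    ← lintegral_indicator measurableSet_Ici]
  refine lintegral_congr fun x => ?_
  simp only [Pi.mul_apply, exponentialPDF_eq, Set.indicator_apply, Set.mem_Ici]
  split_ifs <;> simp

lemma stdExp_ae_pos : ∀ᵐ x ∂stdExp, 0 < x := by
  rw [ae_iff, ← lintegral_indicator_one (by measurability),
    lintegral_stdExp (measurable_one.indicator (by measurability))]
  refine (setLIntegral_congr_fun (g := 0) measurableSet_Ioi fun x hx => ?_).trans (by simp)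
  have : 0 < x := hx
  simp [this]

lemma stdExpPi_ae_pos (m : ℕ) : ∀ᵐ e ∂stdExpPi m, ∀ i, 0 < e i :=
  ae_all_iff.2 fun i => (measurePreserving_eval (fun _ : Fin m => stdExp) i).quasiMeasurePreserving.ae
    stdExp_ae_pos

/-- Memorylessness as an identity of measures, from `exp(-(u + x)) = exp(-u) exp(-x)`. -/
lemma stdExp_inter_Ioi {u : ℝ} (hu : 0 ≤ u) {s : Set ℝ} (hs : MeasurableSet s) :
    stdExp (s ∩ Set.Ioi u) = ENNReal.ofReal (Real.exp (-u)) * stdExp ((fun x => u + x) ⁻¹' s) := by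
  have hsu := measurable_const_add u hs
  rw [← lintegral_indicator_one (hs.inter measurableSet_Ioi), ← lintegral_indicator_one hsu,
    lintegral_stdExp (measurable_one.indicator (hs.inter measurableSet_Ioi)),
    lintegral_stdExp (measurable_one.indicator hsu), ← lintegral_indicator measurableSet_Ioi,
    ← lintegral_indicator measurableSet_Ioi, ← lintegral_const_mul', ← lintegral_add_left_eq_self _ u]
  · refine lintegral_congr fun x => ?_
    by_cases hx : 0 < x
    · have h1 : 0 < u + x := by linarith
      by_cases hxs : u + x ∈ s
      · simp [h1, hx, hxs, Real.exp_add, ENNReal.ofReal_mul, Real.exp_nonneg,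
          mul_comm]
      · simp [Set.indicator_apply, hxs]
    · have : ¬ (u < u + x) := by linarith
      simp [Set.indicator_apply, hx]
  · exact ENNReal.ofReal_ne_top

lemma stdExpPi_restrict_Ioi (m : ℕ) {u : ℝ} (hu : 0 ≤ u) :
    (stdExpPi m).restrict {w | ∀ l, u < w l}
      = ENNReal.ofReal (Real.exp (-(m * u))) • (stdExpPi m).map (fun w l => u + w l) := by
  have hset : {w : Fin m → ℝ | ∀ l, u < w l} = Set.univ.pi fun _ => Set.Ioi u := by
    ext w; simp
  rw [hset, stdExpPi, Measure.restrict_pi_pi]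
  refine Measure.pi_eq fun s hs => ?_
  have hpre : (fun (w : Fin m → ℝ) l => u + w l) ⁻¹' Set.univ.pi s
      = Set.univ.pi fun l => (fun x => u + x) ⁻¹' s l := by
    ext w; simp
  rw [Measure.smul_apply, Measure.map_apply (by fun_prop) (MeasurableSet.univ_pi hs), hpre,
    Measure.pi_pi]
  have : ∀ l, (stdExp.restrict (Set.Ioi u)) (s l)
      = ENNReal.ofReal (Real.exp (-u)) * stdExp ((fun x => u + x) ⁻¹' s l) := fun l => by
    rw [Measure.restrict_apply (hs l), stdExp_inter_Ioi hu (hs l)]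
  simp only [this, Finset.prod_mul_distrib, Finset.prod_const, Finset.card_univ, Fintype.card_fin,
    smul_eq_mul]
  rw [← ENNReal.ofReal_pow (Real.exp_nonneg _), ← Real.exp_nat_mul, mul_neg]

/-- Condition on the minimum, attained at `i` with value `u`: the density there is `exp(-u)` and the
`m` survivors contribute `exp(-m u)`, leaving fresh exponentials above `u`. -/
lemma lintegral_stdExpPi_argmin {m : ℕ} {Φ : (Fin (m + 1) → ℝ) → ℝ≥0∞} (hΦ : Measurable Φ)
    (hsymm : ∀ e (σ : Equiv.Perm (Fin (m + 1))), Φ (e ∘ σ) = Φ e) (i : Fin (m + 1)) :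
    ∫⁻ e in {e | ∀ l, e i < e (i.succAbove l)}, Φ e ∂stdExpPi (m + 1)
      = ∫⁻ u in Set.Ioi 0, ENNReal.ofReal (Real.exp (-((m + 1) * u))) *
          ∫⁻ e, Φ (Fin.cons u fun l => u + e l) ∂stdExpPi m := by
  have hmeas : MeasurableSet {e : Fin (m + 1) → ℝ | ∀ l, e i < e (i.succAbove l)} := by
    have : {e : Fin (m + 1) → ℝ | ∀ l, e i < e (i.succAbove l)}
        = ⋂ l, {e | e i < e (i.succAbove l)} := by ext; simp
    rw [this]
    exact MeasurableSet.iInter fun l =>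
      measurableSet_lt (measurable_pi_apply _) (measurable_pi_apply _)
  have hcons : Measurable fun p : ℝ × (Fin m → ℝ) => (Fin.cons p.1 p.2 : Fin (m + 1) → ℝ) := by
    refine measurable_pi_iff.2 fun j => ?_
    refine Fin.cases ?_ (fun l => ?_) j
    · exact measurable_fst
    · exact (measurable_pi_apply l).comp measurable_snd
  have hS : MeasurableSet {p : ℝ × (Fin m → ℝ) | ∀ l, p.1 < p.2 l} := by
    have : {p : ℝ × (Fin m → ℝ) | ∀ l, p.1 < p.2 l} = ⋂ l, {p | p.1 < p.2 l} := by ext; simp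
    rw [this]
    exact MeasurableSet.iInter fun l =>
      measurableSet_lt measurable_fst ((measurable_pi_apply _).comp measurable_snd)
  have hmp := (measurePreserving_piFinSuccAbove (fun _ : Fin (m + 1) => stdExp) i).symm
  have h1 : ∫⁻ e in {e | ∀ l, e i < e (i.succAbove l)}, Φ e ∂stdExpPi (m + 1)
      = ∫⁻ p, {p : ℝ × (Fin m → ℝ) | ∀ l, p.1 < p.2 l}.indicator
          (fun p => Φ (Fin.cons p.1 p.2)) p ∂(stdExp.prod (stdExpPi m)) := by
    rw [← lintegral_indicator hmeas, stdExpPi, ← hmp.lintegral_comp (hΦ.indicator hmeas)]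
    refine lintegral_congr fun p => ?_
    have : (MeasurableEquiv.piFinSuccAbove (fun _ : Fin (m + 1) => ℝ) i).symm p
      = i.insertNth p.1 p.2 := rfl
    rw [this]
    simp only [Set.indicator_apply, Set.mem_ofPred_eq, Fin.insertNth_apply_same,
      Fin.insertNth_apply_succAbove]
    -- Insertion at position `i` is insertion at the front followed by a cycle, which a symmetric
    -- `Φ` ignores.
    rw [← Fin.cons_comp_cycleRange, hsymm]
  have hind : Measurable ({p : ℝ × (Fin m → ℝ) | ∀ l, p.1 < p.2 l}.indicator
      (fun p => Φ (Fin.cons p.1 p.2))) := (hΦ.comp hcons).indicator hS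
  rw [h1, lintegral_prod _ hind.aemeasurable, lintegral_stdExp hind.lintegral_prod_right']
  refine setLIntegral_congr_fun measurableSet_Ioi fun u hu => ?_
  have hu : (0 : ℝ) < u := hu
  have hset : MeasurableSet {w : Fin m → ℝ | ∀ l, u < w l} := measurable_prodMk_left hS
  have h2 : ∫⁻ w, {p : ℝ × (Fin m → ℝ) | ∀ l, p.1 < p.2 l}.indicator
      (fun p => Φ (Fin.cons p.1 p.2)) (u, w) ∂(stdExpPi m)
      = ∫⁻ w in {w | ∀ l, u < w l}, Φ (Fin.cons u w) ∂stdExpPi m := by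
    rw [← lintegral_indicator hset]
    rfl
  have hΦu : Measurable fun w : Fin m → ℝ => Φ (Fin.cons u w) :=
    hΦ.comp (hcons.comp measurable_prodMk_left)
  rw [h2, stdExpPi_restrict_Ioi m hu.le, lintegral_smul_measure,
    lintegral_map hΦu (by fun_prop), smul_eq_mul, ← mul_assoc,
    ← ENNReal.ofReal_mul (Real.exp_nonneg _), ← Real.exp_add]
  congr 3
  ring

lemma lintegral_exp_neg_mul_Ioi {a : ℝ} (ha : 0 < a) :
    ∫⁻ u in Set.Ioi 0, ENNReal.ofReal (a * Real.exp (-(a * u))) = 1 := by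
  rw [← lintegral_exponentialPDF_eq_one ha, setLIntegral_congr Ioi_ae_eq_Ici,
    ← lintegral_indicator measurableSet_Ici]
  refine lintegral_congr fun x => ?_
  simp only [exponentialPDF_eq, Set.indicator_apply, Set.mem_Ici]
  split_ifs <;> simp

/-- Memoryless decomposition: the minimum of `m + 1` independent standard exponentials is
exponential with rate `m + 1`, and the excesses of the others over it are again `m` independent
standard exponentials. -/
lemma lintegral_stdExpPi_succ {m : ℕ} {Φ : (Fin (m + 1) → ℝ) → ℝ≥0∞} (hΦ : Measurable Φ)
    (hsymm : ∀ e (σ : Equiv.Perm (Fin (m + 1))), Φ (e ∘ σ) = Φ e) :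
    ∫⁻ e, Φ e ∂stdExpPi (m + 1)
      = ∫⁻ u in Set.Ioi 0, ENNReal.ofReal ((m + 1) * Real.exp (-((m + 1) * u))) *
          ∫⁻ e, Φ (Fin.cons u fun l => u + e l) ∂stdExpPi m := by
  set S : Fin (m + 1) → Set (Fin (m + 1) → ℝ) := fun i => {e | ∀ l, e i < e (i.succAbove l)}
    with hS
  have hmeas : ∀ i, MeasurableSet (S i) := fun i => by
    have : S i = ⋂ l, {e | e i < e (i.succAbove l)} := by ext; simp [hS]
    rw [this]
    exact MeasurableSet.iInter fun l =>
      measurableSet_lt (measurable_pi_apply _) (measurable_pi_apply _)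
  have hdisj : Pairwise (Function.onFun Disjoint S) := by
    intro i j hij
    rw [Function.onFun, Set.disjoint_left]
    intro e hi hj
    obtain ⟨l, hl⟩ := Fin.exists_succAbove_eq hij
    obtain ⟨l', hl'⟩ := Fin.exists_succAbove_eq hij.symm
    have h1 := hi l'
    have h2 := hj l
    rw [hl'] at h1
    rw [hl] at h2
    exact lt_asymm h1 h2
  have hsum : ∀ Ψ : (Fin (m + 1) → ℝ) → ℝ≥0∞, Measurable Ψ →
      (∀ e (σ : Equiv.Perm (Fin (m + 1))), Ψ (e ∘ σ) = Ψ e) →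
      ∫⁻ e in ⋃ i, S i, Ψ e ∂stdExpPi (m + 1)
      = ∫⁻ u in Set.Ioi 0, ENNReal.ofReal ((m + 1) * Real.exp (-((m + 1) * u))) *
          ∫⁻ e, Ψ (Fin.cons u fun l => u + e l) ∂stdExpPi m := by
    intro Ψ hΨ hs
    rw [lintegral_iUnion hmeas hdisj, tsum_fintype]
    simp only [hS, lintegral_stdExpPi_argmin hΨ hs, Finset.sum_const, Finset.card_univ,
      Fintype.card_fin, nsmul_eq_mul]
    rw [← lintegral_const_mul' _ _ (ENNReal.natCast_ne_top _)]
    refine lintegral_congr fun u => ?_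
    rw [← mul_assoc, ENNReal.ofReal_mul (by positivity)]
    congr 2
    rw [← Nat.cast_succ, ENNReal.ofReal_natCast]
  -- Taking `Ψ = 1` shows that the regions with a strict minimum have total mass one, so ties need
  -- no separate argument.
  have hone := hsum (fun _ => 1) measurable_const (fun _ _ => rfl)
  simp only [lintegral_const, Measure.restrict_apply_univ, measure_univ, mul_one, one_mul] at hone
  rw [lintegral_exp_neg_mul_Ioi (by positivity)] at hone
  have hae : ∀ᵐ e ∂stdExpPi (m + 1), e ∈ ⋃ i, S i :=
    (prob_compl_eq_zero_iff (MeasurableSet.iUnion hmeas)).2 hone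
  rw [← hsum Φ hΦ hsymm, Measure.restrict_eq_self_of_ae_mem hae]

end StdExp

/-! ### Exact laws and moments of exponential order statistics and spacings. -/

section OrderStatLaw

/-- The density, at positive arguments, of the `j`-th largest of `m` independent standard
exponential variables. -/
noncomputable def orderStatDensity (m j : ℕ) (x : ℝ) : ℝ :=
  j * m.choose j * (Real.exp (-(j * x)) * (1 - Real.exp (-x)) ^ (m - j))

lemma measurable_orderStatDensity (m j : ℕ) : Measurable (orderStatDensity m j) := by
  unfold orderStatDensity; fun_prop

lemma continuous_orderStatDensity (m j : ℕ) : Continuous (orderStatDensity m j) := by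
  unfold orderStatDensity; fun_prop

lemma orderStatDensity_nonneg (m j : ℕ) {x : ℝ} (hx : 0 ≤ x) : 0 ≤ orderStatDensity m j x := by
  have : Real.exp (-x) ≤ 1 := Real.exp_le_one_iff.2 (by linarith)
  have : 0 ≤ (1 - Real.exp (-x)) ^ (m - j) := pow_nonneg (by linarith) _
  unfold orderStatDensity
  positivity

/-- The density counterpart of the memoryless decomposition: adding an independent exponential of
rate `m + 1` raises the sample size by one and keeps the rank `j`. -/
lemma integral_orderStatDensity_mul_exp {m j : ℕ} (hjm : j ≤ m) (y : ℝ) :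
    ∫ x in (0 : ℝ)..y, orderStatDensity m j x * ((m + 1) * Real.exp (-((m + 1) * (y - x))))
      = orderStatDensity (m + 1) j y := by
  obtain ⟨d, rfl⟩ := Nat.exists_eq_add_of_le hjm
  have hchoose : ((j + d + 1 : ℕ) : ℝ) * (j + d).choose j = (j + d + 1).choose j * (d + 1) := by
    have h := Nat.add_one_mul_choose_eq (j + d) d
    have h1 : (j + d).choose d = (j + d).choose j := by rw [Nat.choose_symm_add]
    have h2 : (j + d + 1).choose (d + 1) = (j + d + 1).choose j := by
      rw [add_assoc, Nat.choose_symm_add]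
    rw [h1, h2] at h
    exact_mod_cast h
  -- Up to constants the integrand is `exp x * (exp x - 1) ^ d`, hence the primitive with exponent
  -- `d + 1`; `hchoose` absorbs the factor `d + 1`.
  have hder : ∀ x, HasDerivAt (fun x : ℝ => j * (j + d + 1).choose j *
      (Real.exp (-((j + d + 1) * y)) * (Real.exp x - 1) ^ (d + 1)))
      (orderStatDensity (j + d) j x *
        (((j + d : ℕ) + 1) * Real.exp (-(((j + d : ℕ) + 1) * (y - x))))) x := by
    intro x
    have h1 := (((Real.hasDerivAt_exp x).sub_const 1).fun_pow (d + 1)).const_mul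
      (j * (j + d + 1).choose j * Real.exp (-((j + d + 1) * y)) : ℝ)
    simp only [add_tsub_cancel_right, Nat.cast_add, Nat.cast_one] at h1
    refine (h1.congr_deriv ?_).congr_of_eventuallyEq (.of_forall fun z => by ring)
    · unfold orderStatDensity
      have he : (Real.exp x - 1) = Real.exp x * (1 - Real.exp (-x)) := by
        rw [mul_sub, mul_one, ← Real.exp_add, add_neg_cancel, Real.exp_zero]
      have hexp : Real.exp (-(j * x)) * Real.exp (-((j + d + 1) * (y - x)))
          = Real.exp (-((j + d + 1) * y)) * (Real.exp x ^ d * Real.exp x) := by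
        rw [← Real.exp_nat_mul, ← Real.exp_add, ← Real.exp_add, ← Real.exp_add]
        congr 1
        ring
      rw [he, mul_pow, add_tsub_cancel_left]
      push_cast at hchoose ⊢
      linear_combination -(j * (1 - Real.exp (-x)) ^ d * (j + d + 1) * (j + d).choose j) * hexp
        - (j * (1 - Real.exp (-x)) ^ d * (Real.exp (-((j + d + 1) * y)) * (Real.exp x ^ d * Real.exp x)))
          * hchoose
  rw [intervalIntegral.integral_eq_sub_of_hasDerivAt (fun x _ => hder x)
    (Continuous.intervalIntegrable
      ((continuous_orderStatDensity _ _).mul (by fun_prop)) _ _)]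
  simp only [Real.exp_zero, sub_self, ne_eq, Nat.add_eq_zero_iff, one_ne_zero, and_false,
    not_false_eq_true, zero_pow, mul_zero, sub_zero]
  unfold orderStatDensity
  have he : (Real.exp y - 1) = Real.exp y * (1 - Real.exp (-y)) := by
    rw [mul_sub, mul_one, ← Real.exp_add, add_neg_cancel, Real.exp_zero]
  have hexp : Real.exp (-(j * y)) = Real.exp (-((j + d + 1) * y)) * Real.exp y ^ (d + 1) := by
    rw [← Real.exp_nat_mul, ← Real.exp_add]
    congr 1
    push_cast
    ring
  have hsub : j + d + 1 - j = d + 1 := by omega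
  rw [he, mul_pow, hsub, hexp]
  ring

/-- Tonelli and translation invariance: the law of an independent sum has the convolution density.
Extending both densities by zero puts the integrals on the whole line. -/
lemma lintegral_conv_exp {f g : ℝ → ℝ} {M : ℝ} (hf : Continuous f) (hM : 0 ≤ M)
    (hf0 : ∀ x, 0 ≤ x → 0 ≤ f x)
    (hfg : ∀ y, 0 ≤ y → ∫ x in (0 : ℝ)..y, f x * (M * Real.exp (-(M * (y - x)))) = g y)
    {Φ : ℝ → ℝ≥0∞} (hΦ : Measurable Φ) :
    ∫⁻ u in Set.Ioi 0, ENNReal.ofReal (M * Real.exp (-(M * u))) *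
        ∫⁻ x in Set.Ioi 0, ENNReal.ofReal (f x) * Φ (u + x)
      = ∫⁻ y in Set.Ioi 0, ENNReal.ofReal (g y) * Φ y := by
  set K : ℝ → ℝ≥0∞ := (Set.Ioi 0).indicator fun u => ENNReal.ofReal (M * Real.exp (-(M * u)))
    with hK
  set F : ℝ → ℝ≥0∞ := (Set.Ioi 0).indicator fun x => ENNReal.ofReal (f x) with hF
  have hKm : Measurable K := Measurable.indicator (by fun_prop) measurableSet_Ioi
  have hFm : Measurable F :=
    (hf.measurable.ennreal_ofReal).indicator measurableSet_Ioi
  have hL : ∫⁻ u in Set.Ioi 0, ENNReal.ofReal (M * Real.exp (-(M * u))) *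
        ∫⁻ x in Set.Ioi 0, ENNReal.ofReal (f x) * Φ (u + x)
      = ∫⁻ u, ∫⁻ x, K u * (F x * Φ (u + x)) := by
    rw [← lintegral_indicator measurableSet_Ioi]
    refine lintegral_congr fun u => ?_
    rw [lintegral_const_mul _ (by fun_prop), hK, Set.indicator_mul_left,
      ← lintegral_indicator measurableSet_Ioi]
    simp only [hF, Set.indicator_mul_left]
  have hshift : ∀ x, ∫⁻ u, K u * (F x * Φ (u + x)) = ∫⁻ y, Φ y * (F x * K (y - x)) := by
    intro x
    rw [← lintegral_sub_right_eq_self (fun u => K u * (F x * Φ (u + x))) x]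
    refine lintegral_congr fun y => ?_
    rw [sub_add_cancel]
    ring
  rw [hL, lintegral_lintegral_swap (by fun_prop)]
  simp only [hshift]
  rw [lintegral_lintegral_swap (by fun_prop), ← lintegral_indicator measurableSet_Ioi]
  refine lintegral_congr fun y => ?_
  rw [lintegral_const_mul _ (by fun_prop), Set.indicator_mul_left, mul_comm]
  by_cases hy : 0 < y
  · rw [Set.indicator_of_mem (by exact hy)]
    congr 1
    rw [← hfg y hy.le, intervalIntegral.integral_of_le hy.le, integral_Ioc_eq_integral_Ioo,
      ofReal_integral_eq_lintegral_ofReal, ← lintegral_indicator measurableSet_Ioo]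
    · refine lintegral_congr fun x => ?_
      by_cases h0 : 0 < x
      · by_cases h1 : x < y
        · simp [hK, hF, h0, h1, ENNReal.ofReal_mul (hf0 x h0.le)]
        · simp [hK, hF, h0, h1]
      · simp [hF, h0]
    · exact (Continuous.integrableOn_Icc (by fun_prop)).mono_set Set.Ioo_subset_Icc_self
    · filter_upwards [ae_restrict_mem measurableSet_Ioo] with x hx
      have := hf0 x hx.1.le
      simp only [Pi.zero_apply]
      positivity
  · rw [Set.indicator_of_notMem (by simpa using hy), zero_mul]
    refine mul_eq_zero_of_left ?_ _
    rw [← lintegral_zero (μ := (volume : Measure ℝ))]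
    refine lintegral_congr fun x => ?_
    by_cases h0 : 0 < x
    · have : ¬ x < y := by linarith
      simp [hK, this]
    · simp [hF, h0]

/-- Strip off minima until only `j` variables remain; there the `j`-th largest is the minimum, of
rate `j`. -/
lemma lintegral_orderStat {m j : ℕ} (hj : 1 ≤ j) (hjm : j ≤ m) {Φ : ℝ → ℝ≥0∞}
    (hΦ : Measurable Φ) :
    ∫⁻ e, Φ (orderStat e j) ∂stdExpPi m
      = ∫⁻ x in Set.Ioi 0, ENNReal.ofReal (orderStatDensity m j x) * Φ x := by
  induction m, hjm using Nat.le_induction generalizing Φ with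
  | base =>
    obtain ⟨j, rfl⟩ : ∃ i, j = i + 1 := ⟨j - 1, by omega⟩
    rw [lintegral_stdExpPi_succ (Φ := fun e => Φ (orderStat e (j + 1)))
      (hΦ.comp (measurable_orderStat _)) fun e σ => by rw [orderStat_comp_perm]]
    refine setLIntegral_congr_fun measurableSet_Ioi fun u _ => ?_
    have : ∫⁻ e, Φ (orderStat (Fin.cons u fun l => u + e l : Fin (j + 1) → ℝ) (j + 1)) ∂stdExpPi j
        = Φ u := by
      rw [lintegral_congr_ae (g := fun _ => Φ u), lintegral_const, measure_univ, mul_one]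
      filter_upwards [stdExpPi_ae_pos j] with e he
      rw [orderStat_cons_add_last he]
    rw [this]
    simp [orderStatDensity]
  | succ m hjm ih =>
    rw [lintegral_stdExpPi_succ (Φ := fun e => Φ (orderStat e j))
      (hΦ.comp (measurable_orderStat _)) fun e σ => by rw [orderStat_comp_perm]]
    rw [← lintegral_conv_exp (continuous_orderStatDensity m j) (by positivity)
      (fun x hx => orderStatDensity_nonneg m j hx)
      (fun y _ => integral_orderStatDensity_mul_exp hjm y) hΦ]
    refine setLIntegral_congr_fun measurableSet_Ioi fun u _ => ?_
    have : ∫⁻ e, Φ (orderStat (Fin.cons u fun l => u + e l : Fin (m + 1) → ℝ) j) ∂stdExpPi m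
        = ∫⁻ e, Φ (u + orderStat e j) ∂stdExpPi m := by
      refine lintegral_congr_ae ?_
      filter_upwards [stdExpPi_ae_pos m] with e he
      rw [orderStat_cons_add he hj hjm]
    rw [this, ih (Φ := fun x => Φ (u + x)) (hΦ.comp (measurable_const_add u))]

lemma map_orderStat_stdExpPi {m j : ℕ} (hj : 1 ≤ j) (hjm : j ≤ m) :
    (stdExpPi m).map (fun e => orderStat e j)
      = (volume.restrict (Set.Ioi 0)).withDensity
          fun x => ENNReal.ofReal (orderStatDensity m j x) := by
  refine Measure.ext_of_lintegral _ fun Φ hΦ => ?_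
  rw [lintegral_map hΦ (measurable_orderStat j), lintegral_orderStat hj hjm hΦ,
    lintegral_withDensity_eq_lintegral_mul _
      (measurable_orderStatDensity m j).ennreal_ofReal hΦ]
  rfl

lemma integral_orderStat {m j : ℕ} (hj : 1 ≤ j) (hjm : j ≤ m) {φ : ℝ → ℝ} (hφ : Measurable φ) :
    ∫ e, φ (orderStat e j) ∂stdExpPi m = ∫ x in Set.Ioi 0, orderStatDensity m j x * φ x := by
  rw [← integral_map (φ := fun e : Fin m → ℝ => orderStat e j)
    (measurable_orderStat j).aemeasurable hφ.aestronglyMeasurable, map_orderStat_stdExpPi hj hjm,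
    integral_withDensity_eq_integral_toReal_smul
      (measurable_orderStatDensity m j).ennreal_ofReal (by simp)]
  refine setIntegral_congr_fun measurableSet_Ioi fun x hx => ?_
  simp only [smul_eq_mul]
  rw [ENNReal.toReal_ofReal (orderStatDensity_nonneg m j (le_of_lt hx))]

/-- The sum of the spacings of the `r` largest values above the `(r + 1)`-st largest one. -/
noncomputable def spacingSum {m : ℕ} (r : ℕ) (e : Fin m → ℝ) : ℝ :=
  ∑ j ∈ Finset.Icc 1 r, (orderStat e j - orderStat e (r + 1))

lemma measurable_spacingSum {m : ℕ} (r : ℕ) :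
    Measurable fun e : Fin m → ℝ => spacingSum r e := by
  unfold spacingSum
  exact Finset.measurable_fun_sum _ fun j _ => (measurable_orderStat j).sub (measurable_orderStat _)

/-- Spacings do not see the common shift by the minimum, so the sample can be reduced to size `r +
1`. At that size the spacings are the `r` excesses over the minimum, which are independent
exponentials. -/
lemma lintegral_spacingSum {m r : ℕ} (hrm : r + 1 ≤ m) {Φ : ℝ → ℝ≥0∞} (hΦ : Measurable Φ) :
    ∫⁻ e, Φ (spacingSum r e) ∂stdExpPi m = ∫⁻ e, Φ (∑ i, e i) ∂stdExpPi r := by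
  have hperm : ∀ (m : ℕ) (e : Fin m → ℝ) (σ : Equiv.Perm (Fin m)),
      spacingSum r (e ∘ σ) = spacingSum r e := fun m e σ => by
    simp only [spacingSum, orderStat_comp_perm]
  have hconst : ∀ (m : ℕ) (c : ℝ≥0∞),
      ∫⁻ u in Set.Ioi (0 : ℝ), ENNReal.ofReal ((m + 1) * Real.exp (-((m + 1) * u))) * c = c := by
    intro m c
    rw [lintegral_mul_const _ (by fun_prop), lintegral_exp_neg_mul_Ioi (by positivity), one_mul]
  induction m, hrm using Nat.le_induction with
  | base =>
    rw [lintegral_stdExpPi_succ (Φ := fun e => Φ (spacingSum r e))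
      (hΦ.comp (measurable_spacingSum r))
      fun e σ => by rw [hperm]]
    rw [← hconst r (∫⁻ e, Φ (∑ i, e i) ∂stdExpPi r)]
    refine setLIntegral_congr_fun measurableSet_Ioi fun u _ => ?_
    congr 1
    refine lintegral_congr_ae ?_
    filter_upwards [stdExpPi_ae_pos r] with e he
    rw [spacingSum, orderStat_cons_add_last he, ← sum_orderStat e]
    congr 1
    refine Finset.sum_congr rfl fun j hj => ?_
    rw [Finset.mem_Icc] at hj
    rw [orderStat_cons_add he hj.1 hj.2, add_sub_cancel_left]
  | succ m hrm ih =>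
    rw [lintegral_stdExpPi_succ (Φ := fun e => Φ (spacingSum r e))
      (hΦ.comp (measurable_spacingSum r))
      fun e σ => by rw [hperm], ← ih, ← hconst m (∫⁻ e, Φ (spacingSum r e) ∂stdExpPi m)]
    refine setLIntegral_congr_fun measurableSet_Ioi fun u _ => ?_
    congr 1
    refine lintegral_congr_ae ?_
    filter_upwards [stdExpPi_ae_pos m] with e he
    congr 1
    refine Finset.sum_congr rfl fun j hj => ?_
    rw [Finset.mem_Icc] at hj
    rw [orderStat_cons_add he hj.1 (by omega), orderStat_cons_add he (by omega) hrm]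
    ring

lemma map_spacingSum_stdExpPi {m r : ℕ} (hrm : r + 1 ≤ m) :
    (stdExpPi m).map (spacingSum r) = (stdExpPi r).map fun e => ∑ i, e i := by
  refine Measure.ext_of_lintegral _ fun Φ hΦ => ?_
  rw [lintegral_map hΦ (measurable_spacingSum r), lintegral_spacingSum hrm hΦ,
    lintegral_map hΦ (by fun_prop)]

lemma stdExp_eq_withDensity :
    stdExp = (volume.restrict (Set.Ioi 0)).withDensity fun x => ENNReal.ofReal (Real.exp (-x)) := by
  refine Measure.ext_of_lintegral _ fun Φ hΦ => ?_
  rw [lintegral_stdExp hΦ, lintegral_withDensity_eq_lintegral_mul _ (by fun_prop) hΦ]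
  rfl

lemma integral_stdExp (φ : ℝ → ℝ) :
    ∫ x, φ x ∂stdExp = ∫ x in Set.Ioi 0, Real.exp (-x) * φ x := by
  rw [stdExp_eq_withDensity,
    integral_withDensity_eq_integral_toReal_smul (by fun_prop) (by simp)]
  simp [ENNReal.toReal_ofReal (Real.exp_nonneg _)]

lemma integrable_pow_stdExp (n : ℕ) : Integrable (fun x => x ^ n) stdExp := by
  rw [stdExp_eq_withDensity,
    integrable_withDensity_iff_integrable_smul' (by fun_prop) (by simp)]
  have h := Real.GammaIntegral_convergent (s := n + 1) (by positivity)
  refine h.congr ?_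
  filter_upwards with x
  simp [ENNReal.toReal_ofReal (Real.exp_nonneg _)]

lemma integral_pow_stdExp (n : ℕ) : ∫ x, x ^ n ∂stdExp = n.factorial := by
  rw [integral_stdExp, ← Real.Gamma_nat_eq_factorial, Real.Gamma_eq_integral (by positivity)]
  simp

lemma memLp_two_id_stdExp : MemLp (fun x : ℝ => x) 2 stdExp :=
  (memLp_two_iff_integrable_sq (by fun_prop)).2 (integrable_pow_stdExp 2)

lemma variance_id_stdExp : variance (fun x : ℝ => x) stdExp = 1 := by
  have h1 := integral_pow_stdExp 1
  have h2 := integral_pow_stdExp 2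
  simp only [pow_one] at h1
  rw [variance_eq_sub memLp_two_id_stdExp]
  simp only [Pi.pow_apply]
  rw [h1, h2]
  norm_num [Nat.factorial]

lemma memLp_two_eval_stdExpPi (m : ℕ) (i : Fin m) :
    MemLp (fun e : Fin m → ℝ => e i) 2 (stdExpPi m) :=
  memLp_two_id_stdExp.comp_measurePreserving (measurePreserving_eval (fun _ : Fin m => stdExp) i)

lemma integral_sum_stdExpPi (m : ℕ) : ∫ e, ∑ i, e i ∂stdExpPi m = m := by
  rw [integral_finsetSum _ fun i _ => (memLp_two_eval_stdExpPi m i).integrable one_le_two]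
  have h : ∀ i : Fin m, ∫ e, e i ∂stdExpPi m = 1 := fun i => by
    have h1 := integral_pow_stdExp 1
    simp only [pow_one, Nat.factorial_one, Nat.cast_one] at h1
    rw [← h1, ← (measurePreserving_eval (fun _ : Fin m => stdExp) i).map_eq,
      integral_map (measurable_pi_apply i).aemeasurable (by fun_prop)]
    rfl
  simp [h]

lemma variance_sum_stdExpPi (m : ℕ) : variance (fun e => ∑ i, e i) (stdExpPi m) = m := by
  have h := variance_sum_pi (μ := fun _ : Fin m => stdExp) (X := fun _ x => x)
    fun _ => memLp_two_id_stdExp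
  simp only [variance_id_stdExp, Finset.sum_const, Finset.card_univ, Fintype.card_fin,
    nsmul_eq_mul, mul_one] at h
  rw [← h]
  congr 1
  ext e
  simp

lemma orderStat_pos {m j : ℕ} {e : Fin m → ℝ} (he : ∀ i, 0 < e i) (hj : 1 ≤ j) (hjm : j ≤ m) :
    0 < orderStat e j := by
  obtain ⟨i, hi⟩ := exists_orderStat_eq e hj hjm
  rw [hi]
  exact he i

lemma memLp_two_orderStat {m j : ℕ} (hj : 1 ≤ j) (hjm : j ≤ m) :
    MemLp (fun e : Fin m → ℝ => orderStat e j) 2 (stdExpPi m) := by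
  refine (memLp_finsetSum Finset.univ fun i _ => memLp_two_eval_stdExpPi m i).mono
    (measurable_orderStat j).aestronglyMeasurable ?_
  filter_upwards [stdExpPi_ae_pos m] with e he
  obtain ⟨i, hi⟩ := exists_orderStat_eq e hj hjm
  rw [hi, Real.norm_of_nonneg (he i).le,
    Real.norm_of_nonneg (Finset.sum_nonneg fun l _ => (he l).le)]
  exact Finset.single_le_sum (f := e) (fun l _ => (he l).le) (Finset.mem_univ i)

lemma lintegral_exp_neg_mul_mul_id {a : ℝ} (ha : 0 < a) :
    ∫⁻ u in Set.Ioi 0, ENNReal.ofReal (a * Real.exp (-(a * u))) * ENNReal.ofReal u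
      = ENNReal.ofReal (1 / a) := by
  have hint : ∫ u in Set.Ioi 0, a * Real.exp (-(a * u)) * u = 1 / a := by
    have h := Real.integral_rpow_mul_exp_neg_mul_Ioi (a := 2) (by norm_num) ha
    have h2 : (2 : ℝ) - 1 = 1 := by norm_num
    simp only [h2, Real.rpow_one, Real.Gamma_two, Real.rpow_two, mul_one] at h
    calc ∫ u in Set.Ioi 0, a * Real.exp (-(a * u)) * u
        = ∫ u in Set.Ioi 0, a * (u * Real.exp (-(a * u))) := by
          congr 1 with u
          ring
      _ = 1 / a := by
          rw [integral_const_mul, h]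
          field_simp
  rw [← hint, ofReal_integral_eq_lintegral_ofReal]
  · refine setLIntegral_congr_fun measurableSet_Ioi fun u _ => ?_
    exact (ENNReal.ofReal_mul (by positivity)).symm
  · exact Integrable.of_integral_ne_zero (by rw [hint]; positivity)
  · filter_upwards [ae_restrict_mem measurableSet_Ioi] with u hu
    have : (0 : ℝ) < u := hu
    simp only [Pi.zero_apply]
    positivity

/-- Each stripped minimum of `i` exponentials contributes its mean `1 / i`. This is the origin of
the harmonic sum in `aCoef`. -/
lemma integral_orderStat_eq_harmonic {m j : ℕ} (hj : 1 ≤ j) (hjm : j ≤ m) :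
    ∫ e, orderStat e j ∂stdExpPi m = ∑ i ∈ Finset.Icc j m, 1 / (i : ℝ) := by
  have key : ∫⁻ e, ENNReal.ofReal (orderStat e j) ∂stdExpPi m
      = ENNReal.ofReal (∑ i ∈ Finset.Icc j m, 1 / (i : ℝ)) := by
    induction m, hjm using Nat.le_induction with
    | base =>
      obtain ⟨j, rfl⟩ : ∃ i, j = i + 1 := ⟨j - 1, by omega⟩
      rw [lintegral_stdExpPi_succ (Φ := fun e => ENNReal.ofReal (orderStat e (j + 1)))
        (measurable_orderStat _).ennreal_ofReal fun e σ => by rw [orderStat_comp_perm]]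
      rw [Finset.Icc_self, Finset.sum_singleton, ← lintegral_exp_neg_mul_mul_id (by positivity)]
      refine setLIntegral_congr_fun measurableSet_Ioi fun u _ => ?_
      have : ∫⁻ e, ENNReal.ofReal
          (orderStat (Fin.cons u fun l => u + e l : Fin (j + 1) → ℝ) (j + 1)) ∂stdExpPi j
          = ENNReal.ofReal u := by
        rw [lintegral_congr_ae (g := fun _ => ENNReal.ofReal u), lintegral_const, measure_univ,
          mul_one]
        filter_upwards [stdExpPi_ae_pos j] with e he
        rw [orderStat_cons_add_last he]
      rw [this]
      push_cast
      rfl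
    | succ m hjm ih =>
      rw [lintegral_stdExpPi_succ (Φ := fun e => ENNReal.ofReal (orderStat e j))
        (measurable_orderStat _).ennreal_ofReal fun e σ => by rw [orderStat_comp_perm]]
      have hin : ∀ u ∈ Set.Ioi (0 : ℝ), ENNReal.ofReal ((m + 1) * Real.exp (-((m + 1) * u))) *
          ∫⁻ e, ENNReal.ofReal (orderStat (Fin.cons u fun l => u + e l : Fin (m + 1) → ℝ) j)
            ∂stdExpPi m
          = ENNReal.ofReal ((m + 1) * Real.exp (-((m + 1) * u))) * ENNReal.ofReal u
            + ENNReal.ofReal ((m + 1) * Real.exp (-((m + 1) * u))) *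
              ENNReal.ofReal (∑ i ∈ Finset.Icc j m, 1 / (i : ℝ)) := by
        intro u hu
        rw [← mul_add, ← ih]
        congr 1
        rw [lintegral_congr_ae (g := fun e => ENNReal.ofReal u + ENNReal.ofReal (orderStat e j)),
          lintegral_add_left measurable_const, lintegral_const, measure_univ, mul_one]
        filter_upwards [stdExpPi_ae_pos m] with e he
        rw [orderStat_cons_add he hj hjm, ENNReal.ofReal_add (le_of_lt hu)
          (orderStat_pos he hj hjm).le]
      rw [setLIntegral_congr_fun measurableSet_Ioi hin, lintegral_add_left (by fun_prop),
        lintegral_mul_const _ (by fun_prop), lintegral_exp_neg_mul_mul_id (by positivity),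
        lintegral_exp_neg_mul_Ioi (by positivity), one_mul,
        ← ENNReal.ofReal_add (by positivity) (Finset.sum_nonneg fun i _ => by positivity),
        Finset.sum_Icc_succ_top (by omega), add_comm]
      push_cast
      rfl
  rw [integral_eq_lintegral_of_nonneg_ae _ (measurable_orderStat j).aestronglyMeasurable, key,
    ENNReal.toReal_ofReal (Finset.sum_nonneg fun i _ => by positivity)]
  filter_upwards [stdExpPi_ae_pos m] with e he
  exact (orderStat_pos he hj hjm).le

end OrderStatLaw

/-! ### Second-order regular variation in additive form and Potter bounds. -/

section SecondOrderAnalysis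

/-- Pointwise regular variation of a measurable function, in additive form, is locally bounded. -/
lemma exists_forall_abs_sub_le_of_tendsto {φ : ℝ → ℝ} (hφ : Measurable φ) {ρ : ℝ}
    (h : ∀ x, Tendsto (fun u => φ (u + x) - φ u) atTop (𝓝 (ρ * x))) :
    ∃ K u₀ : ℝ, 0 ≤ K ∧ ∀ u ≥ u₀, ∀ x ∈ Set.Icc (0 : ℝ) 1, |φ (u + x) - φ u| ≤ K := by
  -- Strictly larger than the limiting increment `|ρ y|` on `[0, 2]`, so the bad set `N u` shrinks
  -- to measure zero there.
  set K : ℝ := 2 * |ρ| + 1 with hK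
  set N : ℝ → Set ℝ := fun u => {y | K < |φ (u + y) - φ u|} with hN
  have hNm : ∀ u, MeasurableSet (N u) := fun u =>
    measurableSet_lt measurable_const (by fun_prop)
  have hlim : Tendsto (fun u => ∫⁻ y in Set.Icc (0 : ℝ) 2, (N u).indicator 1 y) atTop
      (𝓝 (∫⁻ _ in Set.Icc (0 : ℝ) 2, 0)) := by
    refine tendsto_lintegral_filter_of_dominated_convergence (fun _ => 1)
      (.of_forall fun u => measurable_one.indicator (hNm u))
      (.of_forall fun u => .of_forall fun y => ?_) (by simp) ?_
    · exact Set.indicator_le_self' (fun _ _ => zero_le_one) y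
    · filter_upwards [ae_restrict_mem measurableSet_Icc] with y hy
      have hlt : |ρ * y| < K := by
        rw [abs_mul, abs_of_nonneg hy.1, hK]
        nlinarith [hy.2, abs_nonneg ρ]
      refine tendsto_const_nhds.congr' ?_
      filter_upwards [(h y).abs.eventually_lt_const hlt] with u hu
      rw [Set.indicator_of_notMem]
      simpa [hN] using hu.le
  rw [lintegral_zero] at hlim
  obtain ⟨u₀, hu₀⟩ := eventually_atTop.1 (hlim.eventually_lt_const (u := 1 / 2) (by simp))
  have hsmall : ∀ u ≥ u₀, volume (N u ∩ Set.Icc 0 2) < 1 / 2 := fun u hu => by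
    have := hu₀ u hu
    rwa [lintegral_indicator_one (hNm u), Measure.restrict_apply (hNm u)] at this
  refine ⟨2 * K, u₀, by positivity, fun u hu x hx => ?_⟩
  -- Two sets of measure below `1/2` cannot cover an interval of length one. A point `z` outside
  -- both compares `φ (u + x)` and `φ u` through `φ (u + z)`.
  have hcover : ¬ (Set.Icc (1 : ℝ) 2 ⊆ (N u ∩ Set.Icc 0 2) ∪
      (fun z => z + -x) ⁻¹' (N (u + x) ∩ Set.Icc 0 2)) := by
    intro hsub
    have h1 := (measure_mono hsub).trans (measure_union_le (μ := volume) _ _)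
    rw [measure_preimage_add_right, Real.volume_Icc] at h1
    have h2 := h1.trans_lt (ENNReal.add_lt_add (hsmall u hu)
      (hsmall (u + x) (by linarith [hx.1])))
    rw [ENNReal.add_halves] at h2
    norm_num at h2
  obtain ⟨z, hz, hzn⟩ := Set.not_subset.1 hcover
  have hz1 : |φ (u + z) - φ u| ≤ K := by
    by_contra! hlt
    exact hzn (Or.inl ⟨hlt, by linarith [hz.1], hz.2⟩)
  have hz2 : |φ (u + z) - φ (u + x)| ≤ K := by
    by_contra! hlt
    refine hzn (Or.inr ⟨?_, by simp only; linarith [hz.1, hx.2], by simp only; linarith [hz.2, hx.1]⟩)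
    have : u + x + (z + -x) = u + z := by ring
    simpa [hN, this] using hlt
  rw [abs_le] at *
  constructor <;> linarith [hz1.1, hz1.2, hz2.1, hz2.2]

/-- The ratio after removing its power part is `1 + z` with `z = O(α) → 0`, so `log (1 + z) = z +
o(z)` passes the limit to logarithms. -/
lemma tendsto_log_increment {L α : ℝ → ℝ} {γ ρ : ℝ} (hα0 : Tendsto α atTop (𝓝 0))
    (hα : ∀ᶠ u in atTop, α u ≠ 0) {x : ℝ}
    (h : Tendsto (fun u => (Real.exp (L (u + x) - L u) - Real.exp (γ * x)) / α u) atTop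
      (𝓝 (Real.exp (γ * x) * ((Real.exp (ρ * x) - 1) / ρ)))) :
    Tendsto (fun u => ((L (u + x) - γ * (u + x)) - (L u - γ * u)) / α u) atTop
      (𝓝 ((Real.exp (ρ * x) - 1) / ρ)) := by
  set z : ℝ → ℝ := fun u => Real.exp ((L (u + x) - γ * (u + x)) - (L u - γ * u)) - 1 with hz
  have hzα : Tendsto (fun u => z u / α u) atTop (𝓝 ((Real.exp (ρ * x) - 1) / ρ)) := by
    have h1 := h.const_mul (Real.exp (-(γ * x)))
    rw [← mul_assoc, ← Real.exp_add, neg_add_cancel, Real.exp_zero, one_mul] at h1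
    refine h1.congr fun u => ?_
    rw [← mul_div_assoc, mul_sub, ← Real.exp_add, ← Real.exp_add, neg_add_cancel, Real.exp_zero]
    simp only [hz]
    congr 3
    ring
  have hz0 : Tendsto z atTop (𝓝 0) := by
    have h1 := hzα.mul hα0
    rw [mul_zero] at h1
    refine h1.congr' ?_
    filter_upwards [hα] with u hu
    exact div_mul_cancel₀ _ hu
  have hlog : (fun w : ℝ => Real.log (1 + w) - w) =o[𝓝 0] fun w => w := by
    have h1 := (Real.hasDerivAt_log one_ne_zero).isLittleO
    have h2 : Tendsto (fun w : ℝ => 1 + w) (𝓝 0) (𝓝 1) := by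
      have : Continuous fun w : ℝ => 1 + w := by fun_prop
      simpa using this.tendsto 0
    simpa [Function.comp_def] using h1.comp_tendsto h2
  have hO : z =O[atTop] α := by
    refine Asymptotics.isBigO_of_div_tendsto_nhds ?_ _ hzα
    filter_upwards [hα] with u hu h0
    exact absurd h0 hu
  have ho := ((hlog.comp_tendsto hz0).trans_isBigO hO).tendsto_div_nhds_zero
  have hsum := ho.add hzα
  rw [zero_add] at hsum
  refine hsum.congr fun u => ?_
  simp only [Function.comp, ← add_div, hz]
  rw [sub_add_cancel, add_sub_cancel, Real.log_exp]

/-- The unit increment of `ℓ` at `u + x` is the difference of its increments over `x + 1` and `x` at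
`u`. Evaluating it with both normalizations forces regular variation of `α`. -/
lemma tendsto_shift_div_of_increment {ℓ α : ℝ → ℝ} {ρ : ℝ} (hρ : ρ < 0)
    (hα : ∀ᶠ u in atTop, α u ≠ 0)
    (h : ∀ x, Tendsto (fun u => (ℓ (u + x) - ℓ u) / α u) atTop
      (𝓝 ((Real.exp (ρ * x) - 1) / ρ))) (x : ℝ) :
    Tendsto (fun u => α (u + x) / α u) atTop (𝓝 (Real.exp (ρ * x))) := by
  have hshift : Tendsto (fun u : ℝ => u + x) atTop atTop := tendsto_atTop_add_const_right _ _ tendsto_id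
  have h1 : (Real.exp (ρ * 1) - 1) / ρ ≠ 0 := by
    have : Real.exp (ρ * 1) < 1 := Real.exp_lt_one_iff.2 (by linarith)
    exact div_ne_zero (by linarith) hρ.ne
  have hn := ((h (x + 1)).sub (h x)).div ((h 1).comp hshift) h1
  have hval : ((Real.exp (ρ * (x + 1)) - 1) / ρ - (Real.exp (ρ * x) - 1) / ρ) /
      ((Real.exp (ρ * 1) - 1) / ρ) = Real.exp (ρ * x) := by
    rw [div_eq_iff h1, mul_add, Real.exp_add]
    ring
  rw [hval] at hn
  refine hn.congr' ?_
  filter_upwards [hα, hshift.eventually hα, ((h 1).comp hshift).eventually_ne h1] with u hu hux hne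
  simp only [Function.comp, Pi.div_apply, ← sub_div, ← add_assoc] at hne ⊢
  have hd : ℓ (u + x + 1) - ℓ (u + x) ≠ 0 := fun h0 => hne (by rw [h0, zero_div])
  have : ℓ (u + x + 1) - ℓ u - (ℓ (u + x) - ℓ u) = ℓ (u + x + 1) - ℓ (u + x) := by ring
  rw [this]
  field_simp

/-- Subtracting `α / ρ` cancels the limiting increments, leaving increments of order `o(α)`. Along
unit steps `α` decays geometrically since `ρ < 0`, so these increments are summable: `D` converges
to `c`, with a tail that is again `o(α)`. -/
lemma exists_tendsto_sub_div {ℓ α : ℝ → ℝ} {ρ : ℝ} (hρ : ρ < 0) (hα0 : Tendsto α atTop (𝓝 0))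
    (hα : ∀ᶠ u in atTop, α u ≠ 0)
    (h : ∀ x, Tendsto (fun u => (ℓ (u + x) - ℓ u) / α u) atTop
      (𝓝 ((Real.exp (ρ * x) - 1) / ρ))) :
    ∃ c, Tendsto (fun u => (ℓ u - c) / α u) atTop (𝓝 (1 / ρ)) := by
  have hrv := tendsto_shift_div_of_increment hρ hα h
  set D : ℝ → ℝ := fun u => ℓ u - α u / ρ with hD
  have hDx : ∀ x, Tendsto (fun u => (D (u + x) - D u) / α u) atTop (𝓝 0) := by
    intro x
    have h1 := (h x).sub (((hrv x).sub_const 1).div_const ρ)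
    rw [sub_self] at h1
    refine h1.congr' ?_
    filter_upwards [hα] with u hu
    simp only [hD]
    field_simp
    ring
  have hDx0 : ∀ x, Tendsto (fun u => D (u + x) - D u) atTop (𝓝 0) := by
    intro x
    have h1 := (hDx x).mul hα0
    rw [mul_zero] at h1
    refine h1.congr' ?_
    filter_upwards [hα] with u hu
    exact div_mul_cancel₀ _ hu
  obtain ⟨θ, hθ1, hθ2⟩ := exists_between (show Real.exp (ρ * 1) < 1 from
    Real.exp_lt_one_iff.2 (by linarith))
  have hθ0 : 0 < θ := (Real.exp_pos _).trans hθ1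
  have hev : ∀ ε > 0, ∃ u₀, ∀ u ≥ u₀, α u ≠ 0 ∧ |α (u + 1)| ≤ θ * |α u| ∧
      |D (u + 1) - D u| ≤ ε * |α u| := by
    intro ε hε
    rw [← eventually_atTop]
    have hθ : |Real.exp (ρ * 1)| < θ := by rwa [abs_of_pos (Real.exp_pos _)]
    filter_upwards [hα, (hrv 1).abs.eventually_lt_const hθ,
      (hDx 1).abs.eventually_lt_const (u := ε) (by simpa using hε)] with u hu h1 h2
    rw [abs_div, div_lt_iff₀ (abs_pos.2 hu)] at h1 h2
    exact ⟨hu, h1.le, h2.le⟩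
  have hgeom : ∀ ε > 0, ∃ u₀, ∀ u ≥ u₀, α u ≠ 0 ∧ ∀ n : ℕ,
      dist (D (u + n)) (D (u + (n + 1 : ℕ))) ≤ ε * |α u| * θ ^ n := by
    intro ε hε
    obtain ⟨u₀, hu₀⟩ := hev ε hε
    refine ⟨u₀, fun u hu => ⟨(hu₀ u hu).1, ?_⟩⟩
    have hpow : ∀ n : ℕ, |α (u + n)| ≤ θ ^ n * |α u| := by
      intro n
      induction n with
      | zero => simp
      | succ n ih =>
        have h1 := (hu₀ (u + n) (by linarith [n.cast_nonneg (α := ℝ)])).2.1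
        push_cast
        rw [← add_assoc, pow_succ']
        calc _ ≤ θ * |α (u + n)| := h1
          _ ≤ θ * (θ ^ n * |α u|) := by gcongr
          _ = _ := by ring
    intro n
    have h1 := (hu₀ (u + n) (by linarith [n.cast_nonneg (α := ℝ)])).2.2
    rw [dist_comm, Real.dist_eq]
    push_cast
    rw [← add_assoc]
    calc _ ≤ ε * |α (u + n)| := h1
      _ ≤ ε * (θ ^ n * |α u|) := by gcongr; exact hpow n
      _ = _ := by ring
  obtain ⟨u₁, hu₁⟩ := hgeom 1 one_pos
  obtain ⟨c, hc⟩ := cauchySeq_tendsto_of_complete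
    (cauchySeq_of_le_geometric θ _ hθ2 (hu₁ u₁ le_rfl).2)
  -- Fixed shifts change `D` by `o(1)`, so the limit along integers does not depend on the base
  -- point.
  have hc' : ∀ u, Tendsto (fun n : ℕ => D (u + n)) atTop (𝓝 c) := by
    intro u
    have h1 := ((hDx0 (u - u₁)).comp
      (tendsto_atTop_add_const_left _ u₁ (tendsto_natCast_atTop_atTop (R := ℝ)))).add hc
    rw [zero_add] at h1
    refine h1.congr fun n => ?_
    simp only [Function.comp]
    rw [sub_add_cancel]
    congr 1
    ring
  refine ⟨c, ?_⟩
  have hlim : Tendsto (fun u => (D u - c) / α u) atTop (𝓝 0) := by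
    rw [Metric.tendsto_atTop]
    intro ε hε
    -- The factor `1 - θ` makes the geometric tail sum to `ε / 2 * |α u|`.
    obtain ⟨u₀, hu₀⟩ := hgeom (ε / 2 * (1 - θ)) (mul_pos (by linarith) (by linarith))
    refine ⟨u₀, fun u hu => ?_⟩
    have h1 := dist_le_of_le_geometric_of_tendsto₀ θ _ hθ2 (hu₀ u hu).2 (hc' u)
    have hpos := abs_pos.2 (hu₀ u hu).1
    rw [Nat.cast_zero, add_zero, Real.dist_eq] at h1
    rw [dist_zero_right, Real.norm_eq_abs, abs_div, div_lt_iff₀ hpos]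
    refine h1.trans_lt ?_
    rw [div_lt_iff₀ (by linarith)]
    have : 0 < ε * |α u| * (1 - θ) := mul_pos (mul_pos hε hpos) (by linarith)
    nlinarith
  have hfin := hlim.add_const (1 / ρ)
  rw [zero_add] at hfin
  refine hfin.congr' ?_
  filter_upwards [hα] with u hu
  simp only [hD]
  have := hρ.ne
  field_simp
  ring

/-- Potter-type bound for a bounded measurable function of exponential-type decay. -/
lemma exists_potter_bound {b : ℝ → ℝ} (hb : Measurable b) {ρ M : ℝ} (hρ : ρ < 0)
    (hne : ∀ᶠ u in atTop, b u ≠ 0) (hM : ∀ u > 0, |b u| ≤ M)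
    (h : ∀ x, Tendsto (fun u => b (u + x) / b u) atTop (𝓝 (Real.exp (ρ * x)))) :
    ∃ C q u₀ : ℝ, 0 ≤ C ∧ 0 ≤ q ∧ ∀ u ≥ u₀, b u ≠ 0 ∧
      ∀ w > 0, |b w| ≤ C * (1 + Real.exp (q * (u - w))) * |b u| := by
  set φ : ℝ → ℝ := fun u => Real.log |b u| with hφ
  have hφm : Measurable φ := by
    have : Measurable fun u => |b u| := by simpa using hb.norm
    exact Real.measurable_log.comp this
  have hshift : ∀ x : ℝ, Tendsto (fun u : ℝ => u + x) atTop atTop := fun x =>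
    tendsto_atTop_add_const_right _ _ tendsto_id
  have hlim : ∀ x, Tendsto (fun u => φ (u + x) - φ u) atTop (𝓝 (ρ * x)) := by
    intro x
    have h1 := ((h x).abs.log (by positivity))
    rw [abs_of_pos (Real.exp_pos _), Real.log_exp] at h1
    refine h1.congr' ?_
    filter_upwards [hne, (hshift x).eventually hne] with u hu hux
    simp only [hφ]
    rw [abs_div, Real.log_div (abs_ne_zero.2 hux) (abs_ne_zero.2 hu)]
  obtain ⟨K, u₁, hK, hu₁⟩ := exists_forall_abs_sub_le_of_tendsto hφm hlim
  obtain ⟨u₂, hu₂⟩ := eventually_atTop.1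
    (hne.and ((hlim 1).eventually_lt_const (u := 0) (by linarith)))
  set u₀ : ℝ := max (max u₁ u₂) 1 with hu₀
  have hu₀1 : u₁ ≤ u₀ := (le_max_left _ _).trans (le_max_left _ _)
  have hu₀2 : u₂ ≤ u₀ := (le_max_right _ _).trans (le_max_left _ _)
  have hpos0 : 1 ≤ u₀ := le_max_right _ _
  have hbne : ∀ u ≥ u₀, b u ≠ 0 := fun u hu => (hu₂ u (hu₀2.trans hu)).1
  have hexp : ∀ u ≥ u₀, Real.exp (φ u) = |b u| := fun u hu =>
    Real.exp_log (abs_pos.2 (hbne u hu))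
  -- Forward unit steps decrease `φ` because `ρ < 0`; only the fractional step costs `K`.
  have hup : ∀ u ≥ u₀, ∀ w ≥ u, φ w ≤ φ u + K := by
    intro u hu w hw
    have hind : ∀ n : ℕ, φ (u + n) ≤ φ u := by
      intro n
      induction n with
      | zero => simp
      | succ n ih =>
        have h1 := (hu₂ (u + n) (by linarith [n.cast_nonneg (α := ℝ)])).2
        push_cast
        rw [← add_assoc]
        linarith
    have hfl := Nat.floor_le (sub_nonneg.2 hw)
    have hfl' := Nat.lt_floor_add_one (w - u)
    have h1 := hu₁ (u + ⌊w - u⌋₊) (by linarith [(Nat.cast_nonneg ⌊w - u⌋₊ : (0 : ℝ) ≤ _)])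
      (w - u - ⌊w - u⌋₊) ⟨by linarith, by linarith⟩
    have he : u + ⌊w - u⌋₊ + (w - u - ⌊w - u⌋₊) = w := by ring
    rw [he] at h1
    linarith [(abs_le.1 h1).2, hind ⌊w - u⌋₊]
  -- Backward, each unit step costs at most `K`; hence the exponential rate `q = K`.
  have hdown : ∀ w ≥ u₀, ∀ u ≥ w, φ w ≤ φ u + K * (u - w + 1) := by
    intro w hw u hu
    have hind : ∀ n : ℕ, φ w ≤ φ (w + n) + K * n := by
      intro n
      induction n with
      | zero => simp
      | succ n ih =>
        have h1 := hu₁ (w + n) (by linarith [n.cast_nonneg (α := ℝ)]) 1 ⟨zero_le_one, le_rfl⟩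
        push_cast
        rw [← add_assoc]
        linarith [(abs_le.1 h1).1]
    have hfl := Nat.floor_le (sub_nonneg.2 hu)
    have hfl' := Nat.lt_floor_add_one (u - w)
    have h1 := hu₁ (w + ⌊u - w⌋₊) (by linarith [(Nat.cast_nonneg ⌊u - w⌋₊ : (0 : ℝ) ≤ _)])
      (u - w - ⌊u - w⌋₊) ⟨by linarith, by linarith⟩
    have he : w + ⌊u - w⌋₊ + (u - w - ⌊u - w⌋₊) = u := by ring
    rw [he] at h1
    have h2 : K * ⌊u - w⌋₊ ≤ K * (u - w) := by gcongr
    linarith [(abs_le.1 h1).1, hind ⌊u - w⌋₊]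
  have hM0 : 0 ≤ M := (abs_nonneg _).trans (hM 1 one_pos)
  have hb0 := abs_pos.2 (hbne u₀ le_rfl)
  -- The first summand serves `w ≥ u₀`. The second serves `w < u₀`, where only the global bound `M`
  -- is available and is rescaled to `|b u₀|`.
  refine ⟨Real.exp K + M / |b u₀| * Real.exp K, K, u₀, by positivity, hK, fun u hu =>
    ⟨hbne u hu, fun w hw => ?_⟩⟩
  have hbu := abs_pos.2 (hbne u hu)
  have hE := Real.exp_pos (K * (u - w))
  have hEK := Real.exp_pos K
  rcases le_total u w with huw | hwu
  · have h1 : |b w| ≤ Real.exp K * |b u| := by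
      rw [← hexp w (hu.trans huw), ← hexp u hu, ← Real.exp_add, add_comm K]
      exact Real.exp_le_exp.2 (hup u hu w huw)
    refine h1.trans (mul_le_mul_of_nonneg_right ?_ hbu.le)
    have h2 : 0 ≤ M / |b u₀| * Real.exp K := by positivity
    nlinarith
  · rcases le_total u₀ w with h0w | hw0
    · have h1 : |b w| ≤ Real.exp K * Real.exp (K * (u - w)) * |b u| := by
        rw [← hexp w h0w, ← hexp u hu, ← Real.exp_add, ← Real.exp_add]
        refine Real.exp_le_exp.2 ((hdown w h0w u hwu).trans (le_of_eq ?_))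
        ring
      refine h1.trans (mul_le_mul_of_nonneg_right ?_ hbu.le)
      have h2 : 0 ≤ M / |b u₀| * Real.exp K := by positivity
      nlinarith [mul_pos hEK hE, mul_nonneg h2 hE.le]
    · have h1 : |b u₀| ≤ Real.exp K * Real.exp (K * (u - w)) * |b u| := by
        rw [← hexp u₀ le_rfl, ← hexp u hu, ← Real.exp_add, ← Real.exp_add]
        refine Real.exp_le_exp.2 ((hdown u₀ le_rfl u hu).trans ?_)
        have : K * (u - u₀ + 1) ≤ K * (u - w + 1) := by gcongr
        linarith
      have h2 : |b w| ≤ M / |b u₀| * |b u₀| := by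
        rw [div_mul_cancel₀ _ hb0.ne']
        exact hM w hw
      have h3 : M / |b u₀| * |b u₀| ≤ M / |b u₀| * (Real.exp K * Real.exp (K * (u - w)) * |b u|) := by
        gcongr
      refine (h2.trans h3).trans ?_
      have h4 : 0 ≤ M / |b u₀| * Real.exp K := by positivity
      have h5 : Real.exp K * Real.exp (K * (u - w)) * (M / |b u₀|) ≤
          (Real.exp K + M / |b u₀| * Real.exp K) * (1 + Real.exp (K * (u - w))) := by
        nlinarith [mul_pos hEK hE, mul_nonneg h4 hE.le]
      calc _ = Real.exp K * Real.exp (K * (u - w)) * (M / |b u₀|) * |b u| := by ring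
        _ ≤ _ := mul_le_mul_of_nonneg_right h5 hbu.le

/-- The deviation of the log-quantile function, in exponential scale, from its linear part. -/
noncomputable def logRemainder (μ : Measure ℝ) (γ c u : ℝ) : ℝ :=
  Real.log (expQuantile μ u) - γ * u - c

lemma measurable_logRemainder (μ : Measure ℝ) (γ c : ℝ) : Measurable (logRemainder μ γ c) :=
  ((Real.measurable_log.comp (measurable_expQuantile μ)).sub (by fun_prop)).sub_const c

lemma tailQuantile_exp (μ : Measure ℝ) {u : ℝ} (hu : 0 < u) :
    tailQuantile μ (Real.exp u) = expQuantile μ u := by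
  rw [expQuantile_of_pos μ hu, tailQuantile, Real.exp_neg, one_div]

/-- The substitution `t = exp u` makes the second-order condition additive, so the preceding lemmas
apply with `α = A ∘ exp`. Eventually `b` is a multiple of `α` with factor near `1 / ρ`, and so
inherits its regular variation. -/
lemma SecondOrder.exists_logRemainder {μ : Measure ℝ} [IsProbabilityMeasure μ]
    (hμ : μ (Set.Iio 1) = 0) {γ ρ : ℝ} {A : ℝ → ℝ} (hρ : ρ < 0)
    (hU : SecondOrder μ γ ρ A) :
    ∃ c, Tendsto (fun u => logRemainder μ γ c u / A (Real.exp u)) atTop (𝓝 (1 / ρ)) ∧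
      Tendsto (logRemainder μ γ c) atTop (𝓝 0) ∧
      (∀ x, Tendsto (fun u => logRemainder μ γ c (u + x) / logRemainder μ γ c u) atTop
        (𝓝 (Real.exp (ρ * x)))) ∧
      (∀ᶠ u in atTop, logRemainder μ γ c u ≠ 0) ∧
      ∃ M, ∀ u > 0, |logRemainder μ γ c u| ≤ M := by
  set α : ℝ → ℝ := fun u => A (Real.exp u) with hαdef
  set L : ℝ → ℝ := fun u => Real.log (expQuantile μ u) with hL
  have hpos : ∀ u, 0 < expQuantile μ u := fun u => one_pos.trans_le (one_le_expQuantile μ hμ u)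
  have hα0 : Tendsto α atTop (𝓝 0) := hU.tendsto_zero.comp Real.tendsto_exp_atTop
  have hshift : ∀ x : ℝ, Tendsto (fun u : ℝ => u + x) atTop atTop := fun x =>
    tendsto_atTop_add_const_right _ _ tendsto_id
  have hratio : ∀ x, Tendsto (fun u => (Real.exp (L (u + x) - L u) - Real.exp (γ * x)) / α u) atTop
      (𝓝 (Real.exp (γ * x) * ((Real.exp (ρ * x) - 1) / ρ))) := by
    intro x
    have h1 := (hU.tendsto_ratio (Real.exp x) (Real.exp_pos x)).comp Real.tendsto_exp_atTop
    simp only [← Real.exp_mul] at h1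
    rw [mul_comm x γ, mul_comm x ρ] at h1
    refine h1.congr' ?_
    filter_upwards [eventually_gt_atTop 0, (hshift x).eventually (eventually_gt_atTop 0)]
      with u hu hux
    simp only [Function.comp, ← Real.exp_add, hL, hαdef]
    rw [tailQuantile_exp μ hu, tailQuantile_exp μ hux, Real.exp_sub, Real.exp_log (hpos _),
      Real.exp_log (hpos _)]
  -- Division by zero returns zero, so the nonzero limit at `x = 1` excludes zeros of `α`
  -- eventually.
  have hα : ∀ᶠ u in atTop, α u ≠ 0 := by
    have hne : Real.exp (γ * 1) * ((Real.exp (ρ * 1) - 1) / ρ) ≠ 0 := by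
      have : Real.exp (ρ * 1) < 1 := Real.exp_lt_one_iff.2 (by linarith)
      exact mul_ne_zero (Real.exp_ne_zero _) (div_ne_zero (by linarith) hρ.ne)
    filter_upwards [(hratio 1).eventually_ne hne] with u hu h0
    exact hu (by rw [h0, div_zero])
  have hinc : ∀ x, Tendsto (fun u => ((L (u + x) - γ * (u + x)) - (L u - γ * u)) / α u) atTop
      (𝓝 ((Real.exp (ρ * x) - 1) / ρ)) := fun x => tendsto_log_increment hα0 hα (hratio x)
  obtain ⟨c, hc⟩ := exists_tendsto_sub_div (ℓ := fun u => L u - γ * u) hρ hα0 hα hinc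
  have hrv := tendsto_shift_div_of_increment (ℓ := fun u => L u - γ * u) hρ hα hinc
  have hρ' : 1 / ρ ≠ 0 := one_div_ne_zero hρ.ne
  have hb0 : Tendsto (logRemainder μ γ c) atTop (𝓝 0) := by
    have h1 := hc.mul hα0
    rw [mul_zero] at h1
    refine h1.congr' ?_
    filter_upwards [hα] with u hu
    exact div_mul_cancel₀ _ hu
  have hbne : ∀ᶠ u in atTop, logRemainder μ γ c u ≠ 0 := by
    filter_upwards [hc.eventually_ne hρ'] with u hu h0
    exact hu (div_eq_zero_iff.2 (Or.inl h0))
  refine ⟨c, hc, hb0, fun x => ?_, hbne, ?_⟩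
  · have h1 := (((hc.comp (hshift x)).mul (hrv x)).div hc hρ')
    rw [mul_div_assoc, mul_comm, div_mul_cancel₀ _ hρ'] at h1
    refine h1.congr' ?_
    filter_upwards [hα, (hshift x).eventually hα, hbne] with u hu hux hb
    have hb' : L u - γ * u - c ≠ 0 := hb
    simp only [Function.comp, Pi.div_apply, logRemainder]
    change (L (u + x) - γ * (u + x) - c) / α (u + x) * (α (u + x) / α u) /
      ((L u - γ * u - c) / α u) = (L (u + x) - γ * (u + x) - c) / (L u - γ * u - c)
    field_simp
  -- Far out the remainder is below one. Below `u₂` the log-quantile is nonnegative, because the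
  -- support lies above `1`, and at most its value at `u₂` by monotonicity.
  · have hev : ∀ᶠ u in atTop, |logRemainder μ γ c u| < 1 :=
      hb0.abs.eventually_lt_const (by simp)
    obtain ⟨u₁, hu₁⟩ := eventually_atTop.1 hev
    set u₂ := max u₁ 1
    have hu₂ : 0 < u₂ := one_pos.trans_le (le_max_right _ _)
    refine ⟨1 + (L u₂ + |γ| * u₂ + |c|), fun u hu => ?_⟩
    have hL0 : ∀ u, 0 ≤ L u := fun u => Real.log_nonneg (one_le_expQuantile μ hμ u)
    have hγ := mul_nonneg (abs_nonneg γ) hu₂.le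
    rcases le_total u₂ u with h | h
    · linarith [(hu₁ u ((le_max_left _ _).trans h)).le, hL0 u₂, abs_nonneg c]
    · have h1 : L u ≤ L u₂ := Real.log_le_log (hpos u) (expQuantile_monotoneOn μ hu hu₂ h)
      have h2 : |γ * u| ≤ |γ| * u₂ := by
        rw [abs_mul, abs_of_pos hu]
        gcongr
      change |L u - γ * u - c| ≤ _
      have h3 := abs_le.1 h2
      have h4 := abs_le.1 (le_refl |c|)
      rw [abs_le]
      constructor <;> linarith [hL0 u, h3.1, h3.2, h4.1, h4.2]

end SecondOrderAnalysis

/-! ### Limits of expectations of exponential order statistics centered at `log m`. -/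

section OrderStatLimit

lemma range_exp_neg : (fun y : ℝ => Real.exp (-y)) '' Set.univ = Set.Ioi 0 := by
  ext s
  simp only [Set.image_univ, Set.mem_range, Set.mem_Ioi]
  refine ⟨fun ⟨y, hy⟩ => hy ▸ Real.exp_pos _, fun hs => ⟨-Real.log s, ?_⟩⟩
  rw [neg_neg, Real.exp_log hs]

lemma hasDerivWithinAt_exp_neg (y : ℝ) :
    HasDerivWithinAt (fun y : ℝ => Real.exp (-y)) (-Real.exp (-y)) Set.univ y := by
  have := (hasDerivAt_neg y).exp
  simp only [mul_neg, mul_one] at this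
  exact this.hasDerivWithinAt

lemma injOn_exp_neg : Set.InjOn (fun y : ℝ => Real.exp (-y)) Set.univ := fun _ _ _ _ h =>
  neg_injective (Real.exp_injective h)

lemma abs_deriv_smul_exp_neg (a c y : ℝ) :
    |(-Real.exp (-y))| • (Real.exp (-y) ^ (a - 1) * Real.exp (-c * Real.exp (-y)))
      = Real.exp (-(a * y)) * Real.exp (-(c * Real.exp (-y))) := by
  rw [abs_neg, abs_of_pos (Real.exp_pos _), smul_eq_mul, ← mul_assoc, ← Real.exp_mul,
    ← Real.exp_add, neg_mul c]
  congr 2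
  ring

lemma integrable_exp_neg_mul_exp_neg_exp {a c : ℝ} (ha : 0 < a) (hc : 0 < c) :
    Integrable fun y : ℝ => Real.exp (-(a * y)) * Real.exp (-(c * Real.exp (-y))) := by
  have h := integrableOn_rpow_mul_exp_neg_mul_rpow (s := a - 1) (p := 1) (b := c) (by linarith)
    one_pos hc
  simp only [Real.rpow_one] at h
  rw [← range_exp_neg, integrableOn_image_iff_integrableOn_abs_deriv_smul MeasurableSet.univ
    (fun y _ => hasDerivWithinAt_exp_neg y) injOn_exp_neg, integrableOn_univ] at h
  exact h.congr (.of_forall fun y => abs_deriv_smul_exp_neg a c y)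

/-- Euler's integral after `s = exp(-y)`; the source of the gamma values in `biasConst`. -/
lemma integral_exp_neg_mul_exp_neg_exp {a : ℝ} (ha : 0 < a) :
    ∫ y : ℝ, Real.exp (-(a * y)) * Real.exp (-Real.exp (-y)) = Real.Gamma a := by
  have h := integral_image_eq_integral_abs_deriv_smul MeasurableSet.univ
    (fun y _ => hasDerivWithinAt_exp_neg y) injOn_exp_neg
    fun s : ℝ => s ^ (a - 1) * Real.exp (-1 * s)
  rw [range_exp_neg, Measure.restrict_univ] at h
  simp only [abs_deriv_smul_exp_neg, one_mul] at h
  rw [← h, Real.Gamma_eq_integral ha]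
  refine setIntegral_congr_fun measurableSet_Ioi fun s _ => ?_
  simp only [neg_mul, one_mul]
  ring

lemma orderStatDensity_add_log {m j : ℕ} (hm : 0 < m) (y : ℝ) :
    orderStatDensity m j (y + Real.log m)
      = j * (m.choose j * (Real.exp (-y) / m) ^ j * (1 - Real.exp (-y) / m) ^ (m - j)) := by
  have hm' : (0 : ℝ) < m := by exact_mod_cast hm
  have h1 : Real.exp (-(y + Real.log m)) = Real.exp (-y) / m := by
    rw [neg_add, Real.exp_add, Real.exp_neg (Real.log m), Real.exp_log hm', div_eq_mul_inv]
  have h2 : Real.exp (-(j * (y + Real.log m))) = (Real.exp (-y) / m) ^ j := by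
    rw [← h1, ← Real.exp_nat_mul, mul_neg]
  rw [orderStatDensity, h1, h2]
  ring

/-- From `m.choose j ≤ m ^ j` and `1 - x ≤ exp(-x)`. The constant `1/2` is a lower bound for `(m -
j) / m` when `2 * j ≤ m`, giving an integrable majorant uniform in `m`. -/
lemma orderStatDensity_add_log_le {m j : ℕ} (hm : 0 < m) (hjm : 2 * j ≤ m) {y : ℝ}
    (hy : -Real.log m < y) :
    orderStatDensity m j (y + Real.log m)
      ≤ j * (Real.exp (-(j * y)) * Real.exp (-(1 / 2 * Real.exp (-y)))) := by
  have hm' : (0 : ℝ) < m := by exact_mod_cast hm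
  rw [orderStatDensity_add_log hm]
  have hx := Real.exp_pos (-y)
  have hxm : Real.exp (-y) / m < 1 := by
    rw [div_lt_one hm', ← Real.lt_log_iff_exp_lt hm']
    linarith
  have h1 : (m.choose j : ℝ) * (Real.exp (-y) / m) ^ j ≤ Real.exp (-(j * y)) := by
    have hc : (m.choose j : ℝ) ≤ (m : ℝ) ^ j := by exact_mod_cast Nat.choose_le_pow m j
    calc (m.choose j : ℝ) * (Real.exp (-y) / m) ^ j
        ≤ (m : ℝ) ^ j * (Real.exp (-y) / m) ^ j := by gcongr
      _ = Real.exp (-(j * y)) := by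
        rw [← mul_pow, mul_div_cancel₀ _ hm'.ne', ← Real.exp_nat_mul, mul_neg]
  have h2 : (1 - Real.exp (-y) / m) ^ (m - j) ≤ Real.exp (-(1 / 2 * Real.exp (-y))) := by
    calc (1 - Real.exp (-y) / m) ^ (m - j) ≤ Real.exp (-(Real.exp (-y) / m)) ^ (m - j) := by
          refine pow_le_pow_left₀ (by linarith) ?_ _
          linarith [Real.add_one_le_exp (-(Real.exp (-y) / m))]
      _ ≤ Real.exp (-(1 / 2 * Real.exp (-y))) := by
          rw [← Real.exp_nat_mul]
          refine Real.exp_le_exp.2 ?_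
          have h3 : (m : ℝ) / 2 ≤ ((m - j : ℕ) : ℝ) := by
            rw [Nat.cast_sub (by omega)]
            have : (2 : ℝ) * j ≤ m := by exact_mod_cast hjm
            linarith
          have h4 : (m : ℝ) / 2 * (Real.exp (-y) / m) ≤ ((m - j : ℕ) : ℝ) * (Real.exp (-y) / m) := by
            gcongr
          have h5 : (m : ℝ) / 2 * (Real.exp (-y) / m) = 1 / 2 * Real.exp (-y) := by
            field_simp
          linarith
  have h6 : (0 : ℝ) ≤ (1 - Real.exp (-y) / m) ^ (m - j) := pow_nonneg (by linarith) _
  gcongr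

/-- The Poisson limit of binomial probabilities, with `m` trials of success probability `exp(-y) /
m`. -/
lemma tendsto_orderStatDensity_add_log {j : ℕ} (hj : 1 ≤ j) (y : ℝ) :
    Tendsto (fun m : ℕ => orderStatDensity m j (y + Real.log m)) atTop
      (𝓝 (Real.exp (-(j * y)) * Real.exp (-Real.exp (-y)) / (j - 1).factorial)) := by
  have hr : Tendsto (fun n : ℕ => (n : ℝ) * (Real.exp (-y) / n)) atTop (𝓝 (Real.exp (-y))) := by
    refine tendsto_const_nhds.congr' ?_
    filter_upwards [eventually_gt_atTop 0] with n hn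
    have : (n : ℝ) ≠ 0 := by positivity
    field_simp
  have h := (tendsto_choose_mul_pow_of_tendsto_mul_atTop j hr).const_mul (j : ℝ)
  have hval : (j : ℝ) * (Real.exp (-Real.exp (-y)) * Real.exp (-y) ^ j / j.factorial)
      = Real.exp (-(j * y)) * Real.exp (-Real.exp (-y)) / (j - 1).factorial := by
    obtain ⟨i, rfl⟩ : ∃ i, j = i + 1 := ⟨j - 1, by omega⟩
    rw [← Real.exp_nat_mul, mul_neg, Nat.factorial_succ, add_tsub_cancel_right]
    push_cast
    field_simp
  refine (Tendsto.congr' ?_ h).trans (by rw [← hval])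
  filter_upwards [eventually_gt_atTop 0] with m hm
  rw [orderStatDensity_add_log hm]

lemma integral_orderStat_sub_log {m j : ℕ} (hj : 1 ≤ j) (hjm : j ≤ m) {φ : ℝ → ℝ}
    (hφ : Measurable φ) :
    ∫ e, φ (orderStat e j - Real.log m) ∂stdExpPi m
      = ∫ y, (Set.Ioi (-Real.log m)).indicator
          (fun y => orderStatDensity m j (y + Real.log m) * φ y) y := by
  rw [integral_orderStat (φ := fun x => φ (x - Real.log m)) hj hjm (by fun_prop),
    ← integral_indicator measurableSet_Ioi,
    ← integral_add_right_eq_self (μ := (volume : Measure ℝ)) _ (Real.log m)]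
  refine integral_congr_ae (.of_forall fun y => ?_)
  have : 0 < y + Real.log m ↔ -Real.log m < y := neg_lt_iff_pos_add.symm
  simp only [Set.indicator_apply, Set.mem_Ioi, this, add_sub_cancel_right]

/-- Dominated convergence. The double exponential absorbs any exponential growth at `-∞`, while `0 <
j + q` secures integrability at `+∞`. -/
lemma tendsto_integral_orderStat_sub_log {j : ℕ} (hj : 1 ≤ j) {φ : ℕ → ℝ → ℝ} {ψ : ℝ → ℝ}
    (hφ : ∀ m, Measurable (φ m)) {C q₁ q₂ : ℝ} (hq₁ : 0 < j + q₁) (hq₂ : 0 < j + q₂)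
    (hbound : ∀ᶠ m : ℕ in atTop, ∀ y > -Real.log m,
      |φ m y| ≤ C * (Real.exp (-(q₁ * y)) + Real.exp (-(q₂ * y))))
    (hlim : ∀ y, Tendsto (fun m => φ m y) atTop (𝓝 (ψ y))) :
    Tendsto (fun m : ℕ => ∫ e, φ m (orderStat e j - Real.log m) ∂stdExpPi m) atTop
      (𝓝 (∫ y, Real.exp (-(j * y)) * Real.exp (-Real.exp (-y)) / (j - 1).factorial * ψ y)) := by
  have hlogm : Tendsto (fun m : ℕ => -Real.log m) atTop atBot :=
    tendsto_neg_atTop_atBot.comp (Real.tendsto_log_atTop.comp tendsto_natCast_atTop_atTop)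
  have hmain : Tendsto (fun m : ℕ => ∫ y, (Set.Ioi (-Real.log m)).indicator
      (fun y => orderStatDensity m j (y + Real.log m) * φ m y) y) atTop
      (𝓝 (∫ y, Real.exp (-(j * y)) * Real.exp (-Real.exp (-y)) / (j - 1).factorial * ψ y)) := by
    refine tendsto_integral_filter_of_dominated_convergence
      (fun y => j * |C| * (Real.exp (-((j + q₁) * y)) * Real.exp (-(1 / 2 * Real.exp (-y)))
        + Real.exp (-((j + q₂) * y)) * Real.exp (-(1 / 2 * Real.exp (-y))))) ?_ ?_ ?_ ?_
    · refine .of_forall fun m => (Measurable.indicator ?_ measurableSet_Ioi).aestronglyMeasurable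
      exact ((measurable_orderStatDensity m j).comp (by fun_prop)).mul (hφ m)
    · filter_upwards [hbound, eventually_gt_atTop 0, eventually_ge_atTop (2 * j)] with m hb hm hjm
      refine .of_forall fun y => ?_
      by_cases hy : -Real.log m < y
      · rw [Set.indicator_of_mem (by exact hy), norm_mul, Real.norm_eq_abs, Real.norm_eq_abs,
          abs_of_nonneg (orderStatDensity_nonneg m j (by linarith))]
        have h1 := orderStatDensity_add_log_le hm hjm hy
        have h2 : |φ m y| ≤ |C| * (Real.exp (-(q₁ * y)) + Real.exp (-(q₂ * y))) :=
          (hb y hy).trans (mul_le_mul_of_nonneg_right (le_abs_self C) (by positivity))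
        refine (mul_le_mul h1 h2 (abs_nonneg _) (by positivity)).trans (le_of_eq ?_)
        have e1 : ∀ q : ℝ, Real.exp (-((j + q) * y))
            = Real.exp (-(j * y)) * Real.exp (-(q * y)) := fun q => by
          rw [← Real.exp_add]
          congr 1
          ring
        rw [e1, e1]
        ring
      · rw [Set.indicator_of_notMem (by simpa using hy), norm_zero]
        positivity
    · exact ((integrable_exp_neg_mul_exp_neg_exp hq₁ (by norm_num)).add
        (integrable_exp_neg_mul_exp_neg_exp hq₂ (by norm_num))).const_mul _
    · refine .of_forall fun y => ?_
      refine ((tendsto_orderStatDensity_add_log hj y).mul (hlim y)).congr' ?_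
      filter_upwards [hlogm.eventually_lt_atBot y] with m hm
      rw [Set.indicator_of_mem (by exact hm)]
  refine hmain.congr' ?_
  filter_upwards [eventually_ge_atTop j] with m hm
  rw [integral_orderStat_sub_log hj hm (hφ m)]

/-- The Potter bound at `u = log m`, `w = log m + y` is the required domination, with rates `0` and
`q`. The factor `exp(ρ y)` shifts the gamma argument from `j` to `j - ρ`. -/
lemma tendsto_integral_remainder_div {b : ℝ → ℝ} (hb : Measurable b) {ρ : ℝ} (hρ : ρ < 0)
    {C q u₀ : ℝ} (hq : 0 ≤ q)
    (hpot : ∀ u ≥ u₀, b u ≠ 0 ∧ ∀ w > 0, |b w| ≤ C * (1 + Real.exp (q * (u - w))) * |b u|)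
    (h : ∀ x, Tendsto (fun u => b (u + x) / b u) atTop (𝓝 (Real.exp (ρ * x))))
    {j : ℕ} (hj : 1 ≤ j) :
    Tendsto (fun m : ℕ => (∫ e, b (orderStat e j) ∂stdExpPi m) / b (Real.log m)) atTop
      (𝓝 (Real.Gamma (j - ρ) / (j - 1).factorial)) := by
  have hlogm : Tendsto (fun m : ℕ => Real.log m) atTop atTop :=
    Real.tendsto_log_atTop.comp tendsto_natCast_atTop_atTop
  have hj' : (1 : ℝ) ≤ j := by exact_mod_cast hj
  have hlim := tendsto_integral_orderStat_sub_log (j := j) hj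
    (φ := fun m y => b (Real.log m + y) / b (Real.log m)) (ψ := fun y => Real.exp (ρ * y))
    (C := C) (q₁ := 0) (q₂ := q) (fun m => by fun_prop) (by linarith) (by linarith)
    (by
      filter_upwards [hlogm.eventually_ge_atTop u₀] with m hm y hy
      obtain ⟨hne, hle⟩ := hpot _ hm
      rw [abs_div, div_le_iff₀ (abs_pos.2 hne)]
      refine (hle (Real.log m + y) (by linarith)).trans (le_of_eq ?_)
      rw [zero_mul, neg_zero, Real.exp_zero, sub_add_cancel_left, mul_neg])
    (fun y => (h y).comp hlogm)
  have hval : ∫ y, Real.exp (-(j * y)) * Real.exp (-Real.exp (-y)) / (j - 1).factorial *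
      Real.exp (ρ * y) = Real.Gamma (j - ρ) / (j - 1).factorial := by
    rw [← integral_exp_neg_mul_exp_neg_exp (a := j - ρ) (by linarith), ← integral_div]
    refine integral_congr_ae (.of_forall fun y => ?_)
    have : Real.exp (-((j - ρ) * y)) = Real.exp (-(j * y)) * Real.exp (ρ * y) := by
      rw [← Real.exp_add]
      congr 1
      ring
    simp only [this]
    ring
  rw [hval] at hlim
  refine hlim.congr fun m => ?_
  rw [← integral_div]
  refine integral_congr_ae (.of_forall fun e => ?_)
  simp only [add_sub_cancel]

lemma tendsto_integral_abs_remainder {b : ℝ → ℝ} (hb : Measurable b) {M : ℝ}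
    (hM : ∀ u > 0, |b u| ≤ M) (h0 : Tendsto b atTop (𝓝 0)) {j : ℕ} (hj : 1 ≤ j) :
    Tendsto (fun m : ℕ => ∫ e, |b (orderStat e j)| ∂stdExpPi m) atTop (𝓝 0) := by
  have hlogm : Tendsto (fun m : ℕ => Real.log m) atTop atTop :=
    Real.tendsto_log_atTop.comp tendsto_natCast_atTop_atTop
  have hj' : (1 : ℝ) ≤ j := by exact_mod_cast hj
  have hM0 : 0 ≤ M := (abs_nonneg _).trans (hM 1 one_pos)
  have hlim := tendsto_integral_orderStat_sub_log (j := j) hj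
    (φ := fun m y => |b (Real.log m + y)|) (ψ := fun _ => 0)
    (C := M) (q₁ := 0) (q₂ := 0)
    (fun m => by simpa using (hb.comp (measurable_const_add (Real.log m))).norm)
    (by linarith) (by linarith)
    (.of_forall fun m y hy => by
      rw [abs_abs]
      refine (hM _ (by linarith)).trans ?_
      rw [zero_mul, neg_zero, Real.exp_zero]
      linarith)
    (fun y => by
      simpa using (h0.comp (tendsto_atTop_add_const_right _ y hlogm)).abs)
  simpa using hlim

/-- The crude bound `y ^ 2 ≤ 2 (exp y + exp(-y))` requires `j - 1 > 0`; it is applied at `j = r +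
1`. -/
lemma exists_integral_orderStat_sub_log_sq_le {j : ℕ} (hj : 2 ≤ j) :
    ∃ V, ∀ᶠ m : ℕ in atTop, ∫ e, (orderStat e j - Real.log m) ^ 2 ∂stdExpPi m ≤ V := by
  have hj' : (2 : ℝ) ≤ j := by exact_mod_cast hj
  have hlim := tendsto_integral_orderStat_sub_log (j := j) (by omega)
    (φ := fun _ y => y ^ 2) (ψ := fun y => y ^ 2)
    (C := 2) (q₁ := -1) (q₂ := 1) (fun m => by fun_prop) (by linarith) (by linarith)
    (.of_forall fun m y _ => by
      rw [abs_of_nonneg (sq_nonneg y), ← sq_abs]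
      have h1 := Real.quadratic_le_exp_of_nonneg (abs_nonneg y)
      have h2 : Real.exp |y| ≤ Real.exp y + Real.exp (-y) := by
        rcases abs_cases y with ⟨h, -⟩ | ⟨h, -⟩ <;> rw [h] <;>
          linarith [Real.exp_pos y, Real.exp_pos (-y)]
      have h3 : -(-1 * y) = y := by ring
      rw [h3, one_mul]
      nlinarith [abs_nonneg y])
    (fun y => tendsto_const_nhds)
  exact ⟨_, hlim.eventually_le_const (lt_add_one _)⟩

end OrderStatLimit

/-! ### Independent blocks of an exponential sequence. -/

section Blocks

/-- The law of a sequence of independent standard exponential variables. -/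
noncomputable def expSeq : Measure (ℕ → ℝ) := Measure.infinitePi fun _ => stdExp

instance : IsProbabilityMeasure expSeq := by unfold expSeq; infer_instance

/-- The `i`-th block of length `m` of a sequence. -/
def block (m i : ℕ) (e : ℕ → ℝ) : Fin m → ℝ := fun l => e (i * m + l)

lemma measurable_block (m i : ℕ) : Measurable (block m i) :=
  measurable_pi_iff.2 fun _ => measurable_pi_apply _

lemma injective_block_index (m : ℕ) :
    Function.Injective fun p : ℕ × Fin m => p.1 * m + (p.2 : ℕ) := by
  rintro ⟨i, l⟩ ⟨i', l'⟩ h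
  have hm : 0 < m := l.pos
  have h1 : (i * m + l) / m = i := by
    rw [mul_comm, Nat.mul_add_div hm, Nat.div_eq_of_lt l.2, add_zero]
  have h2 : (i' * m + l') / m = i' := by
    rw [mul_comm, Nat.mul_add_div hm, Nat.div_eq_of_lt l'.2, add_zero]
  simp only at h
  have hi : i = i' := by rw [← h1, ← h2, h]
  subst hi
  have : (l : ℕ) = l' := by omega
  rw [Fin.ext this]

/-- An injective reindexing of a product measure is a product measure, and currying groups the
coordinates into blocks. -/
lemma map_blocks_expSeq (m : ℕ) :
    expSeq.map (fun e i => block m i e) = Measure.infinitePi fun _ : ℕ => stdExpPi m := by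
  have h1 := Measure.map_infinitePi_infinitePi_of_inj (P := fun _ : ℕ => stdExp)
    (injective_block_index m)
  have h2 := Measure.infinitePi_map_curry (fun (_ : ℕ) (_ : Fin m) => stdExp)
  rw [← h1, Measure.map_map (MeasurableEquiv.measurable _) (by fun_prop)] at h2
  simp only [Measure.infinitePi_eq_pi] at h2
  exact h2

lemma hasLaw_block (m i : ℕ) : HasLaw (block m i) (stdExpPi m) expSeq where
  aemeasurable := (measurable_block m i).aemeasurable
  map_eq := by
    have hm : Measurable fun (e : ℕ → ℝ) i => block m i e :=
      measurable_pi_iff.2 fun i => measurable_block m i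
    have h := Measure.infinitePi_map_eval (fun _ : ℕ => stdExpPi m) i
    rwa [← map_blocks_expSeq, Measure.map_map (measurable_pi_apply i) hm] at h

lemma iIndepFun_block (m : ℕ) : iIndepFun (block m) expSeq :=
  (iIndepFun_iff_hasLaw_Pi_infinitePi (hasLaw_block m)
    (measurable_pi_iff.2 fun i => measurable_block m i).aemeasurable).2
    ⟨(measurable_pi_iff.2 fun i => measurable_block m i).aemeasurable, map_blocks_expSeq m⟩

lemma map_comp_block {m : ℕ} {f : (Fin m → ℝ) → ℝ} (hf : Measurable f) (i : ℕ) :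
    expSeq.map (fun e => f (block m i e)) = (stdExpPi m).map f := by
  rw [← (hasLaw_block m i).map_eq, Measure.map_map hf (measurable_block m i)]
  rfl

lemma identDistrib_comp_block {m : ℕ} {f : (Fin m → ℝ) → ℝ} (hf : Measurable f) (i : ℕ) :
    IdentDistrib (fun e => f (block m i e)) f expSeq (stdExpPi m) :=
  ⟨(hf.comp (measurable_block m i)).aemeasurable, hf.aemeasurable, map_comp_block hf i⟩

lemma integral_mean_block {m : ℕ} {f : (Fin m → ℝ) → ℝ} (hf : Measurable f)
    (hf2 : MemLp f 2 (stdExpPi m)) {k : ℕ} (hk : 0 < k) (s : ℝ) :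
    ∫ e, s * (1 / k * ∑ i ∈ Finset.range k, f (block m i e)) ∂expSeq
      = s * ∫ v, f v ∂stdExpPi m := by
  have hk' : (k : ℝ) ≠ 0 := by positivity
  have hid := fun i => identDistrib_comp_block hf i
  rw [integral_const_mul, integral_const_mul, integral_finsetSum _ fun i _ =>
    ((hid i).memLp_iff.2 hf2).integrable one_le_two]
  simp only [fun i => (hid i).integral_eq, Finset.sum_const, Finset.card_range, nsmul_eq_mul]
  field_simp

lemma memLp_mean_block {m : ℕ} {f : (Fin m → ℝ) → ℝ} (hf : Measurable f)
    (hf2 : MemLp f 2 (stdExpPi m)) (k : ℕ) (s : ℝ) :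
    MemLp (fun e => s * (1 / k * ∑ i ∈ Finset.range k, f (block m i e))) 2 expSeq :=
  ((memLp_finsetSum _ fun i _ => (identDistrib_comp_block hf i).memLp_iff.2 hf2).const_mul
    _).const_mul _

/-- The scale `√(r * k)` exactly undoes the averaging over `k` blocks, so a vanishing single-block
variance suffices. -/
lemma variance_mean_block {m : ℕ} {f : (Fin m → ℝ) → ℝ} (hf : Measurable f)
    (hf2 : MemLp f 2 (stdExpPi m)) {k : ℕ} (hk : 0 < k) (r : ℕ) :
    variance (fun e => √(r * k) * (1 / k * ∑ i ∈ Finset.range k, f (block m i e))) expSeq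
      = r * variance f (stdExpPi m) := by
  have hk' : (k : ℝ) ≠ 0 := by positivity
  have hid := fun i => identDistrib_comp_block hf i
  have hsum : variance (∑ i ∈ Finset.range k, fun e => f (block m i e)) expSeq
      = k * variance f (stdExpPi m) := by
    rw [IndepFun.variance_sum (fun i _ => (hid i).memLp_iff.2 hf2) fun i _ j _ hij =>
      ((iIndepFun_block m).indepFun hij).comp hf hf]
    simp only [fun i => (hid i).variance_eq, Finset.sum_const, Finset.card_range, nsmul_eq_mul]
  have hfun : (∑ i ∈ Finset.range k, fun e => f (block m i e))
      = fun e => ∑ i ∈ Finset.range k, f (block m i e) := by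
    ext e
    simp
  rw [hfun] at hsum
  rw [variance_const_mul, variance_const_mul, hsum, Real.sq_sqrt (by positivity)]
  field_simp

end Blocks

/-! ### Chebyshev's inequality, transfer of laws and the central limit theorem. -/

section Convergence

lemma tendstoInMeasure_of_tendsto_variance {Ω : Type*} [MeasurableSpace Ω] {P : Measure Ω}
    [IsProbabilityMeasure P] {Y : ℕ → Ω → ℝ} {β : ℝ} (hY : ∀ᶠ n in atTop, MemLp (Y n) 2 P)
    (hmean : Tendsto (fun n => ∫ ω, Y n ω ∂P) atTop (𝓝 β))
    (hvar : Tendsto (fun n => variance (Y n) P) atTop (𝓝 0)) :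
    TendstoInMeasure P Y atTop fun _ => β := by
  rw [tendstoInMeasure_iff_norm]
  intro ε hε
  have hbd : Tendsto (fun n => ENNReal.ofReal (variance (Y n) P / (ε / 2) ^ 2)) atTop (𝓝 0) := by
    have h := ENNReal.tendsto_ofReal (hvar.div_const ((ε / 2) ^ 2))
    rwa [zero_div, ENNReal.ofReal_zero] at h
  refine tendsto_of_tendsto_of_tendsto_of_le_of_le' tendsto_const_nhds hbd
    (.of_forall fun _ => bot_le) ?_
  have hm : ∀ᶠ n in atTop, |∫ ω, Y n ω ∂P - β| < ε / 2 := by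
    have := (hmean.sub_const β).abs
    rw [sub_self, abs_zero] at this
    exact this.eventually_lt_const (half_pos hε)
  filter_upwards [hY, hm] with n hn hmn
  refine (measure_mono fun ω hω => ?_).trans (meas_ge_le_variance_div_sq hn (half_pos hε))
  have h1 : ε ≤ |Y n ω - β| := hω
  have h2 := abs_sub_le (Y n ω) (∫ ω, Y n ω ∂P) β
  change ε / 2 ≤ |Y n ω - ∫ ω, Y n ω ∂P|
  linarith

lemma tendstoInDistribution_of_map_eq {Ω₁ Ω₂ Ω₃ Ω₄ : Type*} [MeasurableSpace Ω₁]
    [MeasurableSpace Ω₂] [MeasurableSpace Ω₃] [MeasurableSpace Ω₄] {P₁ : Measure Ω₁}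
    {P₂ : Measure Ω₂} {P₃ : Measure Ω₃} {P₄ : Measure Ω₄} [IsProbabilityMeasure P₁]
    [IsProbabilityMeasure P₂] [IsProbabilityMeasure P₃] [IsProbabilityMeasure P₄]
    {X : ℕ → Ω₁ → ℝ} {Y : ℕ → Ω₂ → ℝ} {Z : Ω₃ → ℝ} {W : Ω₄ → ℝ}
    (h : TendstoInDistribution X atTop Z (fun _ => P₁) P₃) (hY : ∀ n, AEMeasurable (Y n) P₂)
    (hW : AEMeasurable W P₄) (hXY : ∀ n, P₂.map (Y n) = P₁.map (X n))
    (hZW : P₄.map W = P₃.map Z) :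
    TendstoInDistribution Y atTop W (fun _ => P₂) P₄ where
  forall_aemeasurable := hY
  aemeasurable_limit := hW
  tendsto := by
    simp only [hXY, hZW]
    exact h.tendsto

lemma charFun_normalized_sum {m k : ℕ} {f : (Fin m → ℝ) → ℝ} (hf : Measurable f) (t : ℝ) :
    charFun (expSeq.map fun e => (√k)⁻¹ * ∑ i ∈ Finset.range k, f (block m i e)) t
      = (charFun ((stdExpPi m).map f) ((√k)⁻¹ * t)) ^ k := by
  rw [charFun_inv_sqrt_mul_sum (X := fun i e => f (block m i e))
    ((iIndepFun_block m).comp (fun _ => f) fun _ => hf)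
    fun i => (identDistrib_comp_block hf i).trans (identDistrib_comp_block hf 0).symm,
    map_comp_block hf 0]

/-- The block length varies with `n`, but the law of a block's spacing sum does not once `m n ≥ r +
1`. The characteristic functions are then those of the classical i.i.d. theorem, with mean and
variance both `r` before normalization. -/
lemma tendstoInDistribution_spacingSum {r : ℕ} (hr : 1 ≤ r) {k m : ℕ → ℕ}
    (hk : Tendsto k atTop atTop) (hm : Tendsto m atTop atTop) :
    TendstoInDistribution
      (fun n e => (√(k n))⁻¹ * ∑ i ∈ Finset.range (k n), (spacingSum r (block (m n) i e) - r) / √r)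
      atTop id (fun _ => expSeq) (gaussianReal 0 1) where
  forall_aemeasurable n := by
    refine ((Finset.measurable_fun_sum _ fun i _ => ?_).const_mul _).aemeasurable
    exact ((((measurable_spacingSum r).comp (measurable_block _ _))).sub_const _).div_const _
  aemeasurable_limit := aemeasurable_id
  tendsto := by
    have hr' : (r : ℝ) ≠ 0 := by positivity
    have hsq : √(r : ℝ) ^ 2 = r := Real.sq_sqrt (by positivity)
    set X : (Fin r → ℝ) → ℝ := fun e => (∑ i, e i - r) / √r with hX
    have hXm : Measurable X := by fun_prop
    have hS2 : MemLp (fun e : Fin r → ℝ => ∑ i, e i) 2 (stdExpPi r) :=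
      memLp_finsetSum _ fun i _ => memLp_two_eval_stdExpPi r i
    have hmean : (stdExpPi r)[X] = 0 := by
      simp only [hX]
      rw [integral_div, integral_sub (hS2.integrable one_le_two) (integrable_const _),
        integral_sum_stdExpPi]
      simp
    have hsecond : (stdExpPi r)[X ^ 2] = 1 := by
      have h1 := variance_eq_integral hS2.1.aemeasurable
      rw [variance_sum_stdExpPi, integral_sum_stdExpPi] at h1
      simp only [hX, Pi.pow_apply, div_pow]
      rw [integral_div, ← h1, hsq, div_self hr']
    refine ProbabilityMeasure.tendsto_iff_tendsto_charFun.2 fun t => ?_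
    have h := (tendsto_charFun_inv_sqrt_mul_pow hXm.aemeasurable hmean hsecond t).comp hk
    simp only [ProbabilityMeasure.coe_mk, Measure.map_id]
    have hlim : charFun (gaussianReal 0 1) t = Complex.exp (-t ^ 2 / 2) := by
      simp [charFun_gaussianReal, neg_div]
    rw [hlim]
    refine h.congr' ?_
    filter_upwards [hm.eventually_ge_atTop (r + 1)] with n hn
    have hmeas : Measurable fun e : Fin (m n) → ℝ => (spacingSum r e - r) / √r :=
      ((measurable_spacingSum r).sub_const _).div_const _
    have hlaw : (stdExpPi (m n)).map (fun e => (spacingSum r e - r) / √r)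
        = (stdExpPi r).map X := by
      have hg : Measurable fun x : ℝ => (x - r) / √r := by fun_prop
      have h1 := congrArg (Measure.map fun x : ℝ => (x - r) / √r) (map_spacingSum_stdExpPi hn)
      rwa [Measure.map_map hg (measurable_spacingSum r), Measure.map_map hg (by fun_prop)] at h1
    rw [charFun_normalized_sum hmeas, hlaw]
    rfl

end Convergence

/-! ### Exact decomposition of the error, with mean and variance of the residual. -/

section Residual

/-- The contribution of a block to the difference between the normalized quantile error and the
normalized centered spacing sums; `b` is the remainder of the log-quantile function, `l` the
logarithm of the target quantile and `a` the extrapolation coefficient. -/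
noncomputable def blockResidual {m : ℕ} (b : ℝ → ℝ) (γ c : ℝ) (r : ℕ) (a l : ℝ)
    (v : Fin m → ℝ) : ℝ :=
  (c + γ * orderStat v (r + 1) + b (orderStat v (r + 1)) - l) / |a|
    + 1 / r * (∑ j ∈ Finset.Icc 1 r, (b (orderStat v j) - b (orderStat v (r + 1)))) + γ

variable {b : ℝ → ℝ} {γ c : ℝ} {r m : ℕ}

lemma measurable_comp_orderStat (hb : Measurable b) (j : ℕ) :
    Measurable fun v : Fin m → ℝ => b (orderStat v j) := hb.comp (measurable_orderStat j)

lemma measurable_blockResidual (hb : Measurable b) (a l : ℝ) :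
    Measurable fun v : Fin m → ℝ => blockResidual b γ c r a l v := by
  unfold blockResidual
  refine (((((measurable_orderStat _).const_mul γ).const_add c).add
    (measurable_comp_orderStat hb _)).sub_const l |>.div_const _).add
    ((Finset.measurable_fun_sum _ fun j _ => ?_).const_mul _) |>.add_const γ
  exact (measurable_comp_orderStat hb j).sub (measurable_comp_orderStat hb _)

lemma log_expQuantile (μ : Measure ℝ) (γ c u : ℝ) :
    Real.log (expQuantile μ u) = c + γ * u + logRemainder μ γ c u := by
  rw [logRemainder]; ring

lemma log_highQuantile (μ : Measure ℝ) (γ c : ℝ) {p : ℝ} (hp : p ∈ Set.Ioo (0 : ℝ) 1) :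
    Real.log (highQuantile μ p)
      = c - γ * Real.log p + logRemainder μ γ c (-Real.log p) := by
  have h : highQuantile μ p = expQuantile μ (-Real.log p) := by
    rw [expQuantile_of_pos μ (neg_pos.2 (Real.log_neg hp.1 hp.2)), neg_neg, Real.exp_log hp.1,
      highQuantile]
  rw [h, log_expQuantile μ γ c]
  ring

/-- The log-estimator is linear in the logarithms of the order statistics, and `a < 0` gives `-a /
|a| = 1`. The summand `γ` in `blockResidual` compensates the centering of the spacing sums at `r`.
-/
lemma normalized_error_eq (μ : Measure ℝ) (hr : 1 ≤ r) (hrm : r + 1 ≤ m) {k : ℕ} (hk : 0 < k)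
    {p l : ℝ} (ha : aCoef m r p < 0) {e : ℕ → ℝ} (he : ∀ i, 0 < e i) :
    √(r * k) / |aCoef m r p| *
        (Real.log (quantileHat (fun i => expQuantile μ (e i)) k m r p) - l)
      = γ * ((√k)⁻¹ * ∑ i ∈ Finset.range k, (spacingSum r (block m i e) - r) / √r)
        + √(r * k) * (1 / k * ∑ i ∈ Finset.range k,
            blockResidual (logRemainder μ γ c) γ c r (aCoef m r p) l (block m i e)) := by
  have hlog : ∀ i j, 1 ≤ j → j ≤ m →
      Real.log (blockOrderStat (fun i => expQuantile μ (e i)) m i j)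
        = c + γ * orderStat (block m i e) j + logRemainder μ γ c (orderStat (block m i e) j) := by
    intro i j hj hjm
    rw [← log_expQuantile, blockOrderStat]
    congr 1
    exact orderStat_comp_of_monotoneOn (expQuantile_monotoneOn μ) (v := block m i e)
      (fun l => he _) hj hjm
  have hgamma : gammaHat (fun i => expQuantile μ (e i)) k m r = 1 / ((k : ℝ) * r) *
      (γ * ∑ i ∈ Finset.range k, spacingSum r (block m i e)
        + ∑ i ∈ Finset.range k, ∑ j ∈ Finset.Icc 1 r,
          (logRemainder μ γ c (orderStat (block m i e) j)
            - logRemainder μ γ c (orderStat (block m i e) (r + 1)))) := by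
    rw [gammaHat]
    congr 1
    rw [Finset.mul_sum, ← Finset.sum_add_distrib]
    refine Finset.sum_congr rfl fun i _ => ?_
    rw [spacingSum, Finset.mul_sum, ← Finset.sum_add_distrib]
    refine Finset.sum_congr rfl fun j hj => ?_
    rw [Finset.mem_Icc] at hj
    rw [hlog i j hj.1 (by omega), hlog i (r + 1) (by omega) hrm]
    ring
  have hlast : ∑ i ∈ Finset.range k,
      Real.log (blockOrderStat (fun i => expQuantile μ (e i)) m i (r + 1))
      = ∑ i ∈ Finset.range k, (c + γ * orderStat (block m i e) (r + 1)
        + logRemainder μ γ c (orderStat (block m i e) (r + 1))) :=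
    Finset.sum_congr rfl fun i _ => hlog i (r + 1) (by omega) hrm
  rw [quantileHat, Real.log_exp, hgamma, hlast]
  unfold blockResidual
  rw [Finset.sum_add_distrib (g := fun _ => γ), Finset.sum_add_distrib (g := fun i => 1 / (r : ℝ) * _),
    ← Finset.sum_div, ← Finset.sum_div, ← Finset.mul_sum, Finset.sum_sub_distrib,
    Finset.sum_sub_distrib, Finset.sum_const, Finset.sum_const, Finset.sum_const,
    Finset.card_range]
  -- With the sums and square roots abstracted, the claim is a rational identity.
  generalize (∑ i ∈ Finset.range k, (c + γ * orderStat (block m i e) (r + 1)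
        + logRemainder μ γ c (orderStat (block m i e) (r + 1)))) = Z
  generalize (∑ i ∈ Finset.range k, ∑ j ∈ Finset.Icc 1 r,
          (logRemainder μ γ c (orderStat (block m i e) j)
            - logRemainder μ γ c (orderStat (block m i e) (r + 1)))) = B
  generalize (∑ i ∈ Finset.range k, spacingSum r (block m i e)) = S
  have hr0 : (0 : ℝ) < r := by exact_mod_cast hr
  have hk0 : (0 : ℝ) < k := by exact_mod_cast hk
  rw [abs_of_neg ha, Real.sqrt_mul hr0.le]
  have hsr := Real.sqrt_pos.2 hr0
  have hsk := Real.sqrt_pos.2 hk0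
  have hr2 := Real.sq_sqrt hr0.le
  have hk2 := Real.sq_sqrt hk0.le
  generalize √(r : ℝ) = sr at *
  generalize √(k : ℝ) = sk at *
  generalize aCoef m r p = a at *
  have ha' := ha.ne
  simp only [nsmul_eq_mul]
  rw [← hr2, ← hk2]
  field_simp
  ring

lemma memLp_two_comp_orderStat (hb : Measurable b) {M : ℝ} (hM : ∀ u > 0, |b u| ≤ M) {j : ℕ}
    (hj : 1 ≤ j) (hjm : j ≤ m) :
    MemLp (fun v : Fin m → ℝ => b (orderStat v j)) 2 (stdExpPi m) := by
  refine MemLp.of_bound (measurable_comp_orderStat hb j).aestronglyMeasurable M ?_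
  filter_upwards [stdExpPi_ae_pos m] with v hv
  exact hM _ (orderStat_pos hv hj hjm)

lemma memLp_blockResidual (hb : Measurable b) {M : ℝ} (hM : ∀ u > 0, |b u| ≤ M)
    (hrm : r + 1 ≤ m) (a l : ℝ) :
    MemLp (fun v : Fin m → ℝ => blockResidual b γ c r a l v) 2 (stdExpPi m) := by
  have h1 := memLp_two_orderStat (m := m) (j := r + 1) (by omega) hrm
  have h2 := memLp_two_comp_orderStat (m := m) hb hM (j := r + 1) (by omega) hrm
  have h3 : MemLp (fun v : Fin m → ℝ => ∑ j ∈ Finset.Icc 1 r,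
      (b (orderStat v j) - b (orderStat v (r + 1)))) 2 (stdExpPi m) :=
    memLp_finsetSum _ fun j hj => by
      rw [Finset.mem_Icc] at hj
      exact (memLp_two_comp_orderStat hb hM hj.1 (by omega)).sub h2
  have h4 : MemLp (fun v : Fin m → ℝ => c + γ * orderStat v (r + 1)) 2 (stdExpPi m) :=
    (memLp_const c).add (h1.const_mul γ)
  have h5 : MemLp (fun v : Fin m → ℝ => c + γ * orderStat v (r + 1) + b (orderStat v (r + 1)) - l)
      2 (stdExpPi m) := (h4.add h2).sub (memLp_const l)
  have h6 : MemLp (fun v : Fin m → ℝ => (c + γ * orderStat v (r + 1)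
      + b (orderStat v (r + 1)) - l) / |a|) 2 (stdExpPi m) := by
    simpa only [div_eq_mul_inv] using h5.mul_const |a|⁻¹
  exact (h6.add (h3.const_mul (1 / (r : ℝ)))).add (memLp_const γ)

/-- The order statistic of rank `r + 1` has mean `a - log p`, so the linear part contributes `γ a /
|a| = -γ` and cancels the final `γ`. -/
lemma integral_blockResidual (hb : Measurable b) {M : ℝ} (hM : ∀ u > 0, |b u| ≤ M)
    (hrm : r + 1 ≤ m) {p b₀ : ℝ} (ha : aCoef m r p < 0) :
    ∫ v : Fin m → ℝ, blockResidual b γ c r (aCoef m r p) (c - γ * Real.log p + b₀) v ∂stdExpPi m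
      = ((∫ v, b (orderStat v (r + 1)) ∂stdExpPi m) - b₀) / |aCoef m r p|
        + 1 / r * ∑ j ∈ Finset.Icc 1 r,
          ((∫ v, b (orderStat v j) ∂stdExpPi m) - ∫ v, b (orderStat v (r + 1)) ∂stdExpPi m) := by
  have h1 := (memLp_two_orderStat (m := m) (j := r + 1) (by omega) hrm).integrable one_le_two
  have h2 := (memLp_two_comp_orderStat (m := m) hb hM (j := r + 1) (by omega) hrm).integrable
    one_le_two
  have h3 : ∀ j ∈ Finset.Icc 1 r, Integrable (fun v : Fin m → ℝ => b (orderStat v j)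
      - b (orderStat v (r + 1))) (stdExpPi m) := fun j hj => by
    rw [Finset.mem_Icc] at hj
    exact ((memLp_two_comp_orderStat hb hM hj.1 (by omega)).integrable one_le_two).sub h2
  have hlin : Integrable (fun v : Fin m → ℝ => c + γ * orderStat v (r + 1)) (stdExpPi m) :=
    (integrable_const c).add (h1.const_mul γ)
  have hZ : Integrable (fun v : Fin m → ℝ => c + γ * orderStat v (r + 1)
      + b (orderStat v (r + 1))) (stdExpPi m) := hlin.add h2
  have hS : Integrable (fun v : Fin m → ℝ => ∑ j ∈ Finset.Icc 1 r, (b (orderStat v j)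
      - b (orderStat v (r + 1)))) (stdExpPi m) := integrable_finsetSum _ h3
  have hZl : ∀ l a' : ℝ, Integrable (fun v : Fin m → ℝ => (c + γ * orderStat v (r + 1)
      + b (orderStat v (r + 1)) - l) / a') (stdExpPi m) := fun l a' =>
    (hZ.sub (integrable_const l)).div_const a'
  have hZS : ∀ l a' : ℝ, Integrable (fun v : Fin m → ℝ => (c + γ * orderStat v (r + 1)
      + b (orderStat v (r + 1)) - l) / a' + 1 / r * ∑ j ∈ Finset.Icc 1 r, (b (orderStat v j)
      - b (orderStat v (r + 1)))) (stdExpPi m) := fun l a' => (hZl l a').add (hS.const_mul _)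
  unfold blockResidual
  rw [integral_add (hZS _ _) (integrable_const _),
    integral_add (hZl _ _) (hS.const_mul _), integral_div, integral_sub hZ (integrable_const _),
    integral_add hlin h2, integral_add (integrable_const _) (h1.const_mul γ), integral_const_mul,
    integral_const_mul, integral_finsetSum _ h3, integral_orderStat_eq_harmonic (by omega) hrm]
  have hsum : ∑ j ∈ Finset.Icc 1 r, ∫ v, (b (orderStat v j) - b (orderStat v (r + 1))) ∂stdExpPi m
      = ∑ j ∈ Finset.Icc 1 r,
          ((∫ v, b (orderStat v j) ∂stdExpPi m) - ∫ v, b (orderStat v (r + 1)) ∂stdExpPi m) := by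
    refine Finset.sum_congr rfl fun j hj => ?_
    rw [Finset.mem_Icc] at hj
    exact integral_sub
      ((memLp_two_comp_orderStat hb hM hj.1 (by omega)).integrable one_le_two) h2
  rw [hsum, abs_of_neg ha]
  simp only [integral_const, probReal_univ, smul_eq_mul, one_mul]
  have haH : ∑ i ∈ Finset.Icc (r + 1) m, 1 / (i : ℝ) = aCoef m r p - Real.log p := by
    rw [aCoef]; ring
  rw [haH]
  have := ha.ne
  field_simp
  ring

/-- Variance ignores constants, so the order statistic may be recentered at `log m`. Since `|W| ≤ 2
M`, one factor of `W ^ 2` is bounded, leaving first absolute moments of `b`. -/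
lemma variance_blockResidual_le (hb : Measurable b) {M : ℝ} (hM : ∀ u > 0, |b u| ≤ M)
    (hr : 1 ≤ r) (hrm : r + 1 ≤ m) {a : ℝ} (ha : a ≠ 0) (l : ℝ) :
    variance (fun v : Fin m → ℝ => blockResidual b γ c r a l v) (stdExpPi m)
      ≤ (4 * γ ^ 2 * (∫ v, (orderStat v (r + 1) - Real.log m) ^ 2 ∂stdExpPi m) + 4 * M ^ 2) / a ^ 2
        + 4 * M / r * ∑ j ∈ Finset.Icc 1 r,
          ((∫ v, |b (orderStat v j)| ∂stdExpPi m)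
            + ∫ v, |b (orderStat v (r + 1))| ∂stdExpPi m) := by
  have hr0 : (0 : ℝ) < r := by exact_mod_cast hr
  have hM0 : 0 ≤ M := (abs_nonneg _).trans (hM 1 one_pos)
  set W : (Fin m → ℝ) → ℝ := fun v =>
    1 / r * ∑ j ∈ Finset.Icc 1 r, (b (orderStat v j) - b (orderStat v (r + 1))) with hW
  set Q : (Fin m → ℝ) → ℝ := fun v =>
    (γ * (orderStat v (r + 1) - Real.log m) + b (orderStat v (r + 1))) / |a| + W v with hQ
  have hos := measurable_orderStat (m := m) (r + 1)
  have hbm := fun j => measurable_comp_orderStat (m := m) hb j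
  have hWm : Measurable W :=
    (Finset.measurable_fun_sum _ fun j _ => (hbm j).sub (hbm (r + 1))).const_mul _
  have hQm : Measurable Q :=
    ((((hos.sub_const _).const_mul γ).add (hbm (r + 1))).div_const _).add hWm
  have hvar : variance (fun v : Fin m → ℝ => blockResidual b γ c r a l v) (stdExpPi m)
      = variance Q (stdExpPi m) := by
    rw [← variance_add_const hQm.aestronglyMeasurable ((c + γ * Real.log m - l) / |a| + γ)]
    congr 1
    ext v
    simp only [blockResidual, hQ, hW]
    ring
  have hpt : ∀ᵐ v ∂stdExpPi m, Q v ^ 2 ≤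
      4 * γ ^ 2 / a ^ 2 * (orderStat v (r + 1) - Real.log m) ^ 2 + 4 * M ^ 2 / a ^ 2
        + 4 * M / r * ∑ j ∈ Finset.Icc 1 r, (|b (orderStat v j)| + |b (orderStat v (r + 1))|) := by
    filter_upwards [stdExpPi_ae_pos m] with v hv
    have hb1 := hM _ (orderStat_pos hv (j := r + 1) (by omega) hrm)
    have hWabs : |W v| ≤ 1 / r * ∑ j ∈ Finset.Icc 1 r,
        (|b (orderStat v j)| + |b (orderStat v (r + 1))|) := by
      rw [hW, abs_mul, abs_of_nonneg (by positivity)]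
      refine mul_le_mul_of_nonneg_left ((Finset.abs_sum_le_sum_abs _ _).trans
        (Finset.sum_le_sum fun j _ => abs_sub _ _)) (by positivity)
    have hW2 : |W v| ≤ 2 * M := by
      refine hWabs.trans ?_
      have : ∑ j ∈ Finset.Icc 1 r, (|b (orderStat v j)| + |b (orderStat v (r + 1))|)
          ≤ ∑ j ∈ Finset.Icc 1 r, 2 * M := Finset.sum_le_sum fun j hj => by
        rw [Finset.mem_Icc] at hj
        linarith [hM _ (orderStat_pos hv hj.1 (by omega : j ≤ m))]
      rw [Finset.sum_const, Nat.card_Icc, nsmul_eq_mul, add_tsub_cancel_right] at this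
      rw [one_div, inv_mul_le_iff₀ hr0]
      exact this
    have h1 : Q v ^ 2 ≤ 2 * ((γ * (orderStat v (r + 1) - Real.log m) + b (orderStat v (r + 1))) / |a|) ^ 2
        + 2 * W v ^ 2 := by
      simp only [hQ]
      nlinarith [sq_nonneg ((γ * (orderStat v (r + 1) - Real.log m)
        + b (orderStat v (r + 1))) / |a| - W v)]
    have h2 : (γ * (orderStat v (r + 1) - Real.log m) + b (orderStat v (r + 1))) ^ 2
        ≤ 2 * γ ^ 2 * (orderStat v (r + 1) - Real.log m) ^ 2 + 2 * M ^ 2 := by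
      have h3 : b (orderStat v (r + 1)) ^ 2 ≤ M ^ 2 := sq_le_sq' (by linarith [(abs_le.1 hb1).1])
        (abs_le.1 hb1).2
      nlinarith [sq_nonneg (γ * (orderStat v (r + 1) - Real.log m) - b (orderStat v (r + 1)))]
    have h4 : W v ^ 2 ≤ 2 * M * (1 / r * ∑ j ∈ Finset.Icc 1 r,
        (|b (orderStat v j)| + |b (orderStat v (r + 1))|)) := by
      rw [← sq_abs, sq]
      exact mul_le_mul hW2 hWabs (abs_nonneg _) (by linarith)
    have h5 : ((γ * (orderStat v (r + 1) - Real.log m) + b (orderStat v (r + 1))) / |a|) ^ 2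
        ≤ (2 * γ ^ 2 * (orderStat v (r + 1) - Real.log m) ^ 2 + 2 * M ^ 2) / a ^ 2 := by
      rw [div_pow, sq_abs]
      gcongr
    calc Q v ^ 2 ≤ 2 * ((2 * γ ^ 2 * (orderStat v (r + 1) - Real.log m) ^ 2 + 2 * M ^ 2) / a ^ 2)
          + 2 * (2 * M * (1 / r * ∑ j ∈ Finset.Icc 1 r,
            (|b (orderStat v j)| + |b (orderStat v (r + 1))|))) := by linarith
      _ = _ := by ring
  have hi1 : Integrable (fun v : Fin m → ℝ => (orderStat v (r + 1) - Real.log m) ^ 2)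
      (stdExpPi m) :=
    ((memLp_two_orderStat (by omega) hrm).sub (memLp_const _)).integrable_sq
  have hib : ∀ j, 1 ≤ j → j ≤ m → Integrable (fun v : Fin m → ℝ => |b (orderStat v j)|)
      (stdExpPi m) := fun j hj hjm =>
    ((memLp_two_comp_orderStat hb hM hj hjm).integrable one_le_two).abs
  have hi2 : ∀ j ∈ Finset.Icc 1 r, Integrable (fun v : Fin m → ℝ =>
      |b (orderStat v j)| + |b (orderStat v (r + 1))|) (stdExpPi m) := fun j hj => by
    rw [Finset.mem_Icc] at hj
    exact (hib j hj.1 (by omega)).add (hib (r + 1) (by omega) hrm)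
  have hi3 := (integrable_finsetSum _ hi2).const_mul (4 * M / r)
  have hi4 : Integrable (fun v : Fin m → ℝ => 4 * γ ^ 2 / a ^ 2 *
      (orderStat v (r + 1) - Real.log m) ^ 2 + 4 * M ^ 2 / a ^ 2) (stdExpPi m) :=
    (hi1.const_mul (4 * γ ^ 2 / a ^ 2)).add (integrable_const (4 * M ^ 2 / a ^ 2))
  rw [hvar]
  refine (variance_le_expectation_sq hQm.aestronglyMeasurable).trans ?_
  refine (integral_mono_of_nonneg (.of_forall fun v => sq_nonneg _) (hi4.add hi3) hpt).trans
    (le_of_eq ?_)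
  simp only [Pi.add_apply]
  rw [integral_add hi4 hi3, integral_add (hi1.const_mul _) (integrable_const _),
    integral_const_mul, integral_const_mul, integral_finsetSum _ hi2]
  have hsum : ∑ j ∈ Finset.Icc 1 r, ∫ v, (|b (orderStat v j)| + |b (orderStat v (r + 1))|)
        ∂stdExpPi m
      = ∑ j ∈ Finset.Icc 1 r, ((∫ v, |b (orderStat v j)| ∂stdExpPi m)
            + ∫ v, |b (orderStat v (r + 1))| ∂stdExpPi m) := by
    refine Finset.sum_congr rfl fun j hj => ?_
    rw [Finset.mem_Icc] at hj
    exact integral_add (hib j hj.1 (by omega)) (hib (r + 1) (by omega) hrm)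
  rw [hsum]
  simp only [integral_const, probReal_univ, smul_eq_mul, one_mul]
  ring

end Residual

/-! ### Asymptotics of the extrapolation coefficient and of the residual moments. -/

section Asymptotics

lemma aCoef_le {m r : ℕ} {p : ℝ} (hm : 0 < m) (hp : 0 < p) :
    aCoef m r p ≤ 1 + Real.log (m * p) := by
  have hm' : (m : ℝ) ≠ 0 := by positivity
  have h1 : ∑ j ∈ Finset.Icc (r + 1) m, 1 / (j : ℝ) ≤ ∑ j ∈ Finset.Icc 1 m, 1 / (j : ℝ) :=
    Finset.sum_le_sum_of_subset_of_nonneg (Finset.Icc_subset_Icc_left (by omega))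
      fun _ _ _ => by positivity
  have h2 := harmonic_le_one_add_log m
  simp only [harmonic_eq_sum_Icc, Rat.cast_sum, Rat.cast_inv, Rat.cast_natCast] at h2
  simp only [one_div] at h1
  rw [aCoef, Real.log_mul hm' hp.ne']
  simp only [one_div]
  linarith

lemma tendsto_aCoef {m : ℕ → ℕ} {p : ℕ → ℝ} (r : ℕ) (hm : Tendsto m atTop atTop)
    (hp : ∀ n, p n ∈ Set.Ioo (0 : ℝ) 1) (hmp : Tendsto (fun n => (m n : ℝ) * p n) atTop (𝓝 0)) :
    Tendsto (fun n => aCoef (m n) r (p n)) atTop atBot := by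
  have h1 : Tendsto (fun n => (m n : ℝ) * p n) atTop (𝓝[>] 0) := by
    refine tendsto_nhdsWithin_iff.2 ⟨hmp, ?_⟩
    filter_upwards [hm.eventually_gt_atTop 0] with n hn
    have := (hp n).1
    exact Set.mem_Ioi.2 (by positivity)
  refine tendsto_atBot_mono' _ ?_
    (tendsto_atBot_add_const_left _ 1 (Real.tendsto_log_nhdsGT_zero.comp h1))
  filter_upwards [hm.eventually_gt_atTop 0] with n hn
  exact aCoef_le hn (hp n).1

/-- The left side keeps the shape in which the limit arises, with `0` for the terms divided by
`|a|`. The `r` copies of the subtracted term turn `r!` into `(r - 1)!`. -/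
lemma biasConst_eq {r : ℕ} (hr : 1 ≤ r) {ρ : ℝ} (hρ : ρ ≠ 0) (δ : ℝ) :
    √r * (0 + 1 / r * ∑ j ∈ Finset.Icc 1 r,
      (δ * (1 / ρ) * (Real.Gamma (j - ρ) / (j - 1).factorial)
        - δ * (1 / ρ) * (Real.Gamma (((r + 1 : ℕ) : ℝ) - ρ) / (r + 1 - 1).factorial)))
      = δ * biasConst r ρ := by
  have hr0 : (0 : ℝ) < r := by exact_mod_cast hr
  have hsr := Real.sqrt_pos.2 hr0
  have hr2 := Real.sq_sqrt hr0.le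
  have hfac : (r.factorial : ℝ) = r * (r - 1).factorial := by
    exact_mod_cast (Nat.mul_factorial_pred (by omega)).symm
  have hf : ((r - 1).factorial : ℝ) ≠ 0 := by positivity
  rw [Finset.sum_sub_distrib, ← Finset.mul_sum, Finset.sum_const, Nat.card_Icc,
    add_tsub_cancel_right, hfac, nsmul_eq_mul, biasConst]
  push_cast
  generalize ∑ j ∈ Finset.Icc 1 r, Real.Gamma ((j : ℝ) - ρ) / ((j - 1).factorial : ℝ) = G
  have hr1 : (r : ℝ) = √r * √r := (Real.mul_self_sqrt hr0.le).symm
  field_simp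
  rw [hr2]
  ring

variable {b : ℝ → ℝ} {γ ρ c δ M C q u₀ : ℝ} {r : ℕ} {k m : ℕ → ℕ} {p : ℕ → ℝ}

lemma tendsto_integral_blockResidual (hb : Measurable b) (hρ : ρ < 0)
    (hM : ∀ u > 0, |b u| ≤ M) (hq : 0 ≤ q) (hC : 0 ≤ C)
    (hpot : ∀ u ≥ u₀, b u ≠ 0 ∧ ∀ w > 0, |b w| ≤ C * (1 + Real.exp (q * (u - w))) * |b u|)
    (h : ∀ x, Tendsto (fun u => b (u + x) / b u) atTop (𝓝 (Real.exp (ρ * x))))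
    (hr : 1 ≤ r) (hm : Tendsto m atTop atTop)
    (hp : ∀ n, p n ∈ Set.Ioo (0 : ℝ) 1) (hmp : Tendsto (fun n => (m n : ℝ) * p n) atTop (𝓝 0))
    (hbias : Tendsto (fun n => √(k n) * b (Real.log (m n))) atTop (𝓝 (δ * (1 / ρ)))) :
    Tendsto (fun n => √(r * k n) * ∫ v : Fin (m n) → ℝ, blockResidual b γ c r
        (aCoef (m n) r (p n)) (c - γ * Real.log (p n) + b (-Real.log (p n))) v ∂stdExpPi (m n))
      atTop (𝓝 (δ * biasConst r ρ)) := by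
  have ha := tendsto_aCoef r hm hp hmp
  have habs : Tendsto (fun n => |aCoef (m n) r (p n)|) atTop atTop := tendsto_abs_atBot_atTop.comp ha
  have hlogm : Tendsto (fun n => Real.log (m n)) atTop atTop :=
    Real.tendsto_log_atTop.comp (tendsto_natCast_atTop_atTop.comp hm)
  have hE : ∀ j, 1 ≤ j → Tendsto (fun n => √(k n) * ∫ v, b (orderStat v j) ∂stdExpPi (m n)) atTop
      (𝓝 (δ * (1 / ρ) * (Real.Gamma (j - ρ) / (j - 1).factorial))) := by
    intro j hj
    refine (hbias.mul ((tendsto_integral_remainder_div hb hρ hq hpot h hj).comp hm)).congr' ?_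
    filter_upwards [hlogm.eventually_ge_atTop u₀] with n hn
    have hne := (hpot _ hn).1
    simp only [Function.comp]
    field_simp
  -- Eventually `m p ≤ 1`, so `-log p` lies beyond `log m`. The Potter bound then gives `|b(-log p)|
  -- ≤ 2 C |b(log m)|`, and division by `|a|` makes it negligible.
  have hb0 : Tendsto (fun n => √(k n) * b (-Real.log (p n)) / |aCoef (m n) r (p n)|) atTop
      (𝓝 0) := by
    have hbd : Tendsto (fun n => C * 2 * |√(k n) * b (Real.log (m n))| / |aCoef (m n) r (p n)|) atTop
        (𝓝 0) := (hbias.abs.const_mul (C * 2)).div_atTop habs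
    refine squeeze_zero_norm' ?_ hbd
    filter_upwards [hlogm.eventually_ge_atTop u₀, hmp.eventually_le_const zero_lt_one,
      hm.eventually_gt_atTop 0] with n hn hn1 hn0
    have hpn := hp n
    have hm0 : (0 : ℝ) < m n := by exact_mod_cast hn0
    have h1 := (hpot _ hn).2 (-Real.log (p n)) (neg_pos.2 (Real.log_neg hpn.1 hpn.2))
    have h2 : Real.exp (q * (Real.log (m n) - -Real.log (p n))) ≤ 1 := by
      rw [Real.exp_le_one_iff, sub_neg_eq_add, ← Real.log_mul hm0.ne' hpn.1.ne']
      exact mul_nonpos_of_nonneg_of_nonpos hq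
        (Real.log_nonpos (mul_nonneg hm0.le hpn.1.le) hn1)
    have h3 : |b (-Real.log (p n))| ≤ C * 2 * |b (Real.log (m n))| := by
      refine h1.trans (mul_le_mul_of_nonneg_right ?_ (abs_nonneg _))
      exact mul_le_mul_of_nonneg_left (by linarith) hC
    rw [Real.norm_eq_abs, abs_div, abs_abs, abs_mul, abs_mul, abs_of_nonneg (Real.sqrt_nonneg _)]
    refine div_le_div_of_nonneg_right ?_ (abs_nonneg _)
    calc √(k n) * |b (-Real.log (p n))| ≤ √(k n) * (C * 2 * |b (Real.log (m n))|) := by gcongr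
      _ = _ := by ring
  have hlast := hE (r + 1) (by omega)
  have hmain := (((hlast.div_atTop habs).sub hb0).add
    ((tendsto_finsetSum (Finset.Icc 1 r) fun j hj =>
      (hE j (Finset.mem_Icc.1 hj).1).sub hlast).const_mul (1 / (r : ℝ)))).const_mul √r
  rw [sub_zero, biasConst_eq hr hρ.ne] at hmain
  refine hmain.congr' ?_
  filter_upwards [ha.eventually_lt_atBot 0, hm.eventually_ge_atTop (r + 1)] with n hn hmn
  rw [integral_blockResidual hb hM hmn hn, Real.sqrt_mul (Nat.cast_nonneg r), mul_assoc (√(r : ℝ)),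
    mul_add (√(k n : ℝ)), mul_left_comm (√(k n : ℝ)), Finset.mul_sum _ _ (√(k n : ℝ))]
  simp only [mul_sub]
  ring

/-- The bounded second moment is divided by `a ^ 2 → ∞`, and the absolute moments of `b` vanish
because order statistics of fixed rank escape to infinity. -/
lemma tendsto_variance_blockResidual (hb : Measurable b) (hM : ∀ u > 0, |b u| ≤ M)
    (h0 : Tendsto b atTop (𝓝 0)) (hr : 1 ≤ r) (hm : Tendsto m atTop atTop) {a l : ℕ → ℝ}
    (ha : Tendsto a atTop atBot) :
    Tendsto (fun n => variance (fun v : Fin (m n) → ℝ => blockResidual b γ c r (a n) (l n) v)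
      (stdExpPi (m n))) atTop (𝓝 0) := by
  obtain ⟨V, hV⟩ := exists_integral_orderStat_sub_log_sq_le (j := r + 1) (by omega)
  have hsq : Tendsto (fun n => a n ^ 2) atTop atTop := by
    have := (tendsto_pow_atTop (α := ℝ) two_ne_zero).comp (tendsto_abs_atBot_atTop.comp ha)
    exact this.congr fun n => sq_abs _
  have habs := fun j (hj : 1 ≤ j) => (tendsto_integral_abs_remainder hb hM h0 hj).comp hm
  have hbd := ((tendsto_const_nhds (x := 4 * γ ^ 2 * V + 4 * M ^ 2)).div_atTop hsq).add
    ((tendsto_finsetSum (Finset.Icc 1 r) fun j hj =>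
      (habs j (Finset.mem_Icc.1 hj).1).add (habs (r + 1) (by omega))).const_mul (4 * M / r))
  simp only [add_zero, Finset.sum_const_zero, mul_zero] at hbd
  refine squeeze_zero' (.of_forall fun n => variance_nonneg _ _) ?_ hbd
  filter_upwards [hm.eventually hV, hm.eventually_ge_atTop (r + 1), ha.eventually_lt_atBot 0]
    with n hVn hmn han
  refine (variance_blockResidual_le hb hM hr hmn han.ne (l n)).trans ?_
  simp only [Function.comp]
  gcongr

end Asymptotics

/-! ### Measurability and transfer between the exponential model and the data. -/

section Transfer

lemma measurable_quantileHat (k m r : ℕ) (p : ℝ) :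
    Measurable fun x : ℕ → ℝ => quantileHat x k m r p := by
  have hb : ∀ i j, Measurable fun x : ℕ → ℝ => Real.log (blockOrderStat x m i j) := fun i j =>
    Real.measurable_log.comp ((measurable_orderStat j).comp (measurable_block m i))
  unfold quantileHat gammaHat
  refine Real.measurable_exp.comp ((Measurable.const_mul ?_ _).sub (Measurable.const_mul
    (Measurable.const_mul ?_ _) _))
  · exact Finset.measurable_fun_sum _ fun i _ => hb i _
  · exact Finset.measurable_fun_sum _ fun i _ => Finset.measurable_fun_sum _ fun j _ =>
      (hb i j).sub (hb i _)

lemma map_expQuantile_expSeq (μ : Measure ℝ) [IsProbabilityMeasure μ] :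
    expSeq.map (fun e i => expQuantile μ (e i)) = Measure.infinitePi fun _ : ℕ => μ := by
  rw [expSeq, Measure.infinitePi_map_pi _ fun _ => measurable_expQuantile μ]
  congr 1
  ext1 i
  exact map_expQuantile μ

lemma expSeq_ae_pos : ∀ᵐ e ∂expSeq, ∀ i, 0 < e i :=
  ae_all_iff.2 fun i => (measurePreserving_eval_infinitePi
    (fun _ : ℕ => stdExp) i).quasiMeasurePreserving.ae stdExp_ae_pos

lemma map_affine_gaussianReal (γ β : ℝ) :
    (gaussianReal 0 1).map (fun z => γ * z + β) = gaussianReal β (Real.toNNReal (γ ^ 2)) := by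
  have h := Measure.map_map (μ := gaussianReal 0 1) (f := fun z => γ * z) (g := fun z => z + β)
    (by fun_prop) (by fun_prop)
  rw [gaussianReal_map_const_mul, gaussianReal_map_add_const] at h
  simp only [Function.comp_def] at h
  rw [← h]
  congr 1
  · ring
  · ext
    simp [Real.coe_toNNReal _ (sq_nonneg γ)]

end Transfer

end BlockQuantile

/-! ### Assembly of the limit theorem. -/

theorem theorem2
    {Ω : Type*} [MeasurableSpace Ω] (P : Measure Ω) [IsProbabilityMeasure P]
    -- an i.i.d. sequence with law `μ`, bounded below by `1`
    (μ : Measure ℝ) [IsProbabilityMeasure μ]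
    (X : ℕ → Ω → ℝ) (hX_meas : ∀ i, Measurable (X i))
    (hX_law : ∀ i, HasLaw (X i) μ P) (hX_indep : iIndepFun X P)
    (hX_ge : ∀ i, ∀ᵐ ω ∂P, 1 ≤ X i ω)
    -- the second-order condition
    (γ ρ : ℝ) (hγ : 0 < γ) (hρ : ρ < 0) (A : ℝ → ℝ)
    (hU : BlockQuantile.SecondOrder μ γ ρ A)
    -- number of observed order statistics, number and length of the blocks
    (r : ℕ) (hr : 1 ≤ r) (k m : ℕ → ℕ) (hm_def : ∀ n, m n = n / k n)
    (hk : Tendsto k atTop atTop) (hm : Tendsto m atTop atTop)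
    (δ : ℝ) (hδ : Tendsto (fun n => Real.sqrt (k n) * A (m n)) atTop (𝓝 δ))
    -- the quantile levels
    (p : ℕ → ℝ) (hp : ∀ n, p n ∈ Set.Ioo (0 : ℝ) 1)
    (hmp : Tendsto (fun n => (m n : ℝ) * p n) atTop (𝓝 0))
    (hlog : (fun n => Real.log ((m n : ℝ) * p n)) =o[atTop] (fun n => Real.sqrt (k n))) :
    TendstoInDistribution
      (fun (n : ℕ) (ω : Ω) =>
        Real.sqrt ((r : ℝ) * k n) / |BlockQuantile.aCoef (m n) r (p n)| *
          (Real.log (BlockQuantile.quantileHat (fun i => X i ω) (k n) (m n) r (p n))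
            - Real.log (BlockQuantile.highQuantile μ (p n))))
      atTop (id : ℝ → ℝ) (fun _ => P)
      (gaussianReal (δ * BlockQuantile.biasConst r ρ) (Real.toNNReal (γ ^ 2))) := by
  have hμ : μ (Set.Iio 1) = 0 := by
    rw [← (hX_law 0).map_eq, Measure.map_apply (hX_meas 0) measurableSet_Iio]
    refine measure_mono_null (fun ω hω => ?_) (ae_iff.1 (hX_ge 0))
    exact not_le.2 hω
  obtain ⟨c, hbA, hb0, hrv, hne, M, hM⟩ := hU.exists_logRemainder hμ hρ
  have hbm := BlockQuantile.measurable_logRemainder μ γ c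
  obtain ⟨C, q, u₀, hC, hq, hpot⟩ := BlockQuantile.exists_potter_bound hbm hρ hne hM hrv
  have ha := BlockQuantile.tendsto_aCoef r hm hp hmp
  have hlogm : Tendsto (fun n => Real.log (m n)) atTop atTop :=
    Real.tendsto_log_atTop.comp (tendsto_natCast_atTop_atTop.comp hm)
  have hbias : Tendsto (fun n => √(k n) * BlockQuantile.logRemainder μ γ c (Real.log (m n))) atTop
      (𝓝 (δ * (1 / ρ))) := by
    have h1 := hbA.comp hlogm
    refine (hδ.mul h1).congr' ?_
    filter_upwards [h1.eventually_ne (one_div_ne_zero hρ.ne), hm.eventually_gt_atTop 0] with n hn hmn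
    simp only [Function.comp] at hn ⊢
    rw [Real.exp_log (by exact_mod_cast hmn)] at hn ⊢
    have hA : A (m n) ≠ 0 := fun h => hn (by rw [h, div_zero])
    field_simp
  -- Written as a measurable functional of the whole sequence, the statistic has a law determined by
  -- that of the sequence.
  set T : ℕ → (ℕ → ℝ) → ℝ := fun n x => √((r : ℝ) * k n) / |BlockQuantile.aCoef (m n) r (p n)| *
    (Real.log (BlockQuantile.quantileHat x (k n) (m n) r (p n))
      - Real.log (BlockQuantile.highQuantile μ (p n))) with hT
  have hTm : ∀ n, Measurable (T n) := fun n =>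
    ((Real.measurable_log.comp (BlockQuantile.measurable_quantileHat _ _ _ _)).sub_const _).const_mul _
  have hψm : Measurable fun (e : ℕ → ℝ) i => BlockQuantile.expQuantile μ (e i) :=
    measurable_pi_iff.2 fun i =>
      (BlockQuantile.measurable_expQuantile μ).comp (measurable_pi_apply i)
  have hXm : Measurable fun ω i => X i ω := measurable_pi_iff.2 hX_meas
  set S : ℕ → (ℕ → ℝ) → ℝ := fun n e => γ * ((√(k n))⁻¹ * ∑ i ∈ Finset.range (k n),
    (BlockQuantile.spacingSum r (BlockQuantile.block (m n) i e) - r) / √r) with hS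
  have hSm : ∀ n, Measurable (S n) := fun n => by
    refine ((Finset.measurable_fun_sum _ fun i _ => ?_).const_mul _).const_mul _
    exact (((BlockQuantile.measurable_spacingSum r).comp
      (BlockQuantile.measurable_block _ _)).sub_const _).div_const _
  have hSlim : TendstoInDistribution S atTop (fun z => γ * z) (fun _ => BlockQuantile.expSeq)
      (gaussianReal 0 1) :=
    (BlockQuantile.tendstoInDistribution_spacingSum hr hk hm).continuous_comp
      (g := fun z => γ * z) (by fun_prop)
  set R : ∀ n, (Fin (m n) → ℝ) → ℝ := fun n => BlockQuantile.blockResidual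
    (BlockQuantile.logRemainder μ γ c) γ c r (BlockQuantile.aCoef (m n) r (p n))
    (c - γ * Real.log (p n) + BlockQuantile.logRemainder μ γ c (-Real.log (p n))) with hR
  have hRm : ∀ n, Measurable (R n) := fun n => BlockQuantile.measurable_blockResidual hbm _ _
  set Y : ℕ → (ℕ → ℝ) → ℝ := fun n e => √((r : ℝ) * k n) * (1 / k n * ∑ i ∈ Finset.range (k n),
    R n (BlockQuantile.block (m n) i e)) with hY
  have hYm : ∀ n, Measurable (Y n) := fun n =>
    ((Finset.measurable_fun_sum _ fun i _ =>
      (hRm n).comp (BlockQuantile.measurable_block _ _)).const_mul _).const_mul _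
  have hRL : ∀ᶠ n in atTop, MemLp (R n) 2 (BlockQuantile.stdExpPi (m n)) := by
    filter_upwards [hm.eventually_ge_atTop (r + 1)] with n hn
    exact BlockQuantile.memLp_blockResidual hbm hM hn _ _
  have hYlim : TendstoInMeasure BlockQuantile.expSeq Y atTop
      fun _ => δ * BlockQuantile.biasConst r ρ := by
    refine BlockQuantile.tendstoInMeasure_of_tendsto_variance ?_ ?_ ?_
    · filter_upwards [hRL] with n hn
      exact BlockQuantile.memLp_mean_block (hRm n) hn _ _
    · refine (BlockQuantile.tendsto_integral_blockResidual (γ := γ) (c := c) hbm hρ hM hq hC hpot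
        hrv hr hm hp hmp hbias).congr' ?_
      filter_upwards [hRL, hk.eventually_gt_atTop 0] with n hn hkn
      exact (BlockQuantile.integral_mean_block (hRm n) hn hkn _).symm
    · have h1 := (BlockQuantile.tendsto_variance_blockResidual (γ := γ) (c := c)
        (l := fun n => c - γ * Real.log (p n)
          + BlockQuantile.logRemainder μ γ c (-Real.log (p n)))
        hbm hM hb0 hr hm ha).const_mul (r : ℝ)
      rw [mul_zero] at h1
      refine h1.congr' ?_
      filter_upwards [hRL, hk.eventually_gt_atTop 0] with n hn hkn
      exact (BlockQuantile.variance_mean_block (hRm n) hn hkn r).symm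
  have hTY : ∀ᶠ n in atTop, (fun e => T n (fun i => BlockQuantile.expQuantile μ (e i)) - S n e)
      =ᵐ[BlockQuantile.expSeq] Y n := by
    filter_upwards [ha.eventually_lt_atBot 0, hm.eventually_ge_atTop (r + 1),
      hk.eventually_gt_atTop 0] with n han hmn hkn
    filter_upwards [BlockQuantile.expSeq_ae_pos] with e he
    have h1 := BlockQuantile.normalized_error_eq (γ := γ) (c := c) μ hr hmn hkn
      (l := Real.log (BlockQuantile.highQuantile μ (p n))) han he
    rw [sub_eq_iff_eq_add']
    simp only [hT, hS, hY, hR]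
    rw [← BlockQuantile.log_highQuantile μ γ c (hp n)]
    exact h1
  have hTlim : TendstoInDistribution
      (fun n e => T n fun i => BlockQuantile.expQuantile μ (e i)) atTop
      (fun z => γ * z + δ * BlockQuantile.biasConst r ρ) (fun _ => BlockQuantile.expSeq)
      (gaussianReal 0 1) := by
    -- Slutsky: `S` converges in law and the difference from it converges in measure to the bias.
    -- The decomposition is needed only for large `n` and almost everywhere, where `a < 0` and all
    -- exponentials are positive.
    have hmeas : TendstoInMeasure BlockQuantile.expSeq
        (fun n e => T n (fun i => BlockQuantile.expQuantile μ (e i)) - S n e) atTop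
        fun _ => δ * BlockQuantile.biasConst r ρ :=
      hYlim.congr' (hTY.mono fun n hn => hn.symm) (by rfl)
    have h1 := hSlim.add_of_tendstoInMeasure_const hmeas
      fun n => (((hTm n).comp hψm).sub (hSm n)).aemeasurable
    have h2 : (fun n e => T n fun i => BlockQuantile.expQuantile μ (e i))
        = fun n => S n + fun e => T n (fun i => BlockQuantile.expQuantile μ (e i)) - S n e := by
      ext n e
      simp
    rw [h2]
    exact h1
  -- Both the data and the transformed exponentials are i.i.d. sequences with marginal `μ`, so the
  -- statistics agree in law.
  refine BlockQuantile.tendstoInDistribution_of_map_eq hTlim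
    (fun n => ((hTm n).comp hXm).aemeasurable) aemeasurable_id (fun n => ?_) ?_
  · have h1 : P.map (fun ω i => X i ω) = Measure.infinitePi fun _ : ℕ => μ :=
      (hX_indep.hasLaw_infinitePi hX_law hXm.aemeasurable).map_eq
    have h2 := congrArg (Measure.map (T n)) (h1.trans (BlockQuantile.map_expQuantile_expSeq μ).symm)
    rwa [Measure.map_map (hTm n) hXm, Measure.map_map (hTm n) hψm] at h2
  · rw [Measure.map_id, BlockQuantile.map_affine_gaussianReal]
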